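/- A sequence $(X_k)_{k\ge1}$ of random variables on a probability space is exchangeable if, for every $n\ge1$ and every permutation $\sigma$ of $\{1,\dots,n\}$, $(X_{\sigma(1)},\dots,X_{\sigma(n)})$ has the same law as $(X_1,\dots,X_n)$. Write $\bar X_n=\frac1n\sum_{k=1}^nX_k$. For real random variables $X,Y$ (possibly defined on different probability spaces) let $$d_W(X,Y)=\inf_\pi\int_{\mathbb R\times\mathbb R}|x-y|\,\pi(dx,dy)\in[0,\infty],$$ the infimum being over all probability measures $\pi$ on $\mathbb R\times\mathbb R$ whose first marginal is the law of $X$ and whose second marginal is the law of $Y$. For non-negative sequences, $a_n\cong b_n$ means that both $a_n=\mathcal O(b_n)$ and $b_n=\mathcal O(a_n)$ as $n\to\infty$. (i) For every $\delta\in[1/2,1]$ there exists an infinite exchangeable sequence $(X_k)_{k\ge1}$ of random variables with values in $\{0,1\}$ such that $\bar X_n$ converges in distribution and, if $\theta$ is a random variable having the limiting distribution of $\bar X_n$, then $$d_W(\bar X_n,\theta)\cong n^{-\delta}.$$ (ii) Conversely, let $(X_k)_{k\ge1}$ be an infinite exchangeable sequence of random variables with values in $\{0,1\}$. If $d_W(\bar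 X_n,\theta)\cong n^{-\delta}$ for some real random variable $\theta$ and some $\delta>0$, then $\delta\in[1/2,1]$. -/

import Mathlib

open MeasureTheory ProbabilityTheory Filter Asymptotics
open scoped ENNReal Topology

/-- `π` is a coupling of `μ` and `ν`: its first marginal is `μ` and its second marginal is `ν`.
If `μ` is a probability measure, then so is `π`. -/
def IsCoupling (π : Measure (ℝ × ℝ)) (μ ν : Measure ℝ) : Prop :=
  π.map Prod.fst = μ ∧ π.map Prod.snd = ν

/-- The Wasserstein (Kantorovich) distance `inf_π ∫∫ |x - y| π(dx, dy)` of two probability measures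
on `ℝ`, as an extended nonnegative number; the infimum runs over all couplings. -/
noncomputable def wassersteinDist (μ ν : Measure ℝ) : ℝ≥0∞ :=
  ⨅ (π : Measure (ℝ × ℝ)) (_ : IsCoupling π μ ν), ∫⁻ z, ENNReal.ofReal |z.1 - z.2| ∂π

/-- `d_W(X, Y)`: the Wasserstein distance of the laws of the real random variables `X` and `Y`,
which may live on different probability spaces. -/
noncomputable def wassersteinDistRV {Ω Ω' : Type*} [MeasurableSpace Ω] [MeasurableSpace Ω']
    (X : Ω → ℝ) (P : Measure Ω) (Y : Ω' → ℝ) (P' : Measure Ω') : ℝ≥0∞ :=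
  wassersteinDist (P.map X) (P'.map Y)

/-- The sequence `X 0, X 1, …` is exchangeable under `P`: for every `n` and every permutation `σ` of
the first `n` indices, `(X (σ 0), …, X (σ (n - 1)))` has the law of `(X 0, …, X (n - 1))`. -/
def Exchangeable {Ω : Type*} [MeasurableSpace Ω] (X : ℕ → Ω → ℝ) (P : Measure Ω) : Prop :=
  ∀ (n : ℕ) (σ : Equiv.Perm (Fin n)),
    P.map (fun ω (i : Fin n) => X (σ i) ω) = P.map (fun ω (i : Fin n) => X i ω)

/-- An infinite exchangeable sequence of random variables with values in `{0, 1}`. -/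
structure IsExchangeableZeroOne {Ω : Type*} [MeasurableSpace Ω] (X : ℕ → Ω → ℝ)
    (P : Measure Ω) : Prop where
  measurable : ∀ k, Measurable (X k)
  zero_or_one : ∀ k ω, X k ω = 0 ∨ X k ω = 1
  exchangeable : Exchangeable X P

/-- The mean of the first `n` variables of the sequence (only used for `n ≥ 1`). -/
noncomputable def empiricalMean {Ω : Type*} (X : ℕ → Ω → ℝ) (n : ℕ) (ω : Ω) : ℝ :=
  (∑ k ∈ Finset.range n, X k ω) / n

/-- `d_W(X̄_n, θ) ≅ n^{-δ}`, that is, each side is `O` of the other as `n → ∞`. An infinite distance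
(converted to the real number `0`) for infinitely many `n` makes this false, because `n^{-δ}` is
positive for `n ≥ 1`. -/
def HasWassersteinRate {Ω Ω' : Type*} [MeasurableSpace Ω] [MeasurableSpace Ω']
    (X : ℕ → Ω → ℝ) (P : Measure Ω) (θ : Ω' → ℝ) (P' : Measure Ω') (δ : ℝ) : Prop :=
  (fun n : ℕ => (wassersteinDistRV (empiricalMean X n) P θ P').toReal)
    =Θ[atTop] fun n : ℕ => (n : ℝ) ^ (-δ)

/-! ### The Wasserstein distance on the line as the `L¹` distance of distribution functions -/

/-! Converse. Exchangeability determines all second moments, so no de Finetti representation is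
needed: with `v = idiosyncraticVariance X P`, the means of orders `n ≤ m` are at squared `L²`
distance `v (1/n - 1/m) ≤ 1/n`. If the distances `D n` to the law of `θ` tend to `0`, the triangle
inequality with `m → ∞` gives `D n ≤ 1/√n`, hence `δ ≥ 1/2`. If `δ > 1`, then `n D n → 0`. The mean
of order `n` lives on the lattice `ℤ/n`, so `E dist(nθ, ℤ) ≤ n D n`; since `θ = (n+1)θ - nθ`, `θ` is
almost surely an integer (`lintegral_dist_int_eq_zero`). Testing with `dist(·, ℤ)`, which dominates
`x(1-x)` on `[0,1]`, gives `v (1 - 1/n) ≤ D n → 0`, so `v ≤ 0`. All `X k` then coincide almost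
surely and `D n` is eventually constant, hence zero, against the lower bound.

Existence. For Bernoulli variables with random parameter of law `ν`, duality turns the distance into
the supremum of `∫ (B_n f - f) dν` over 1-Lipschitz `f`, where `B_n` is the Bernstein operator.
Pointwise the error is at most `1/√n`, but its Lebesgue integral over any subinterval of `[0,1]` is
only `O(1/n)` (`abs_integral_bernsteinMean_sub_le`). A uniform prior of radius `ρ` about `1/2` thus
costs at most `min(1/√n, 1/(ρn))`. From below, `f = |x - 1/2|` has nonnegative error, of order
`1/√n` when `|p - 1/2| ≲ 1/√n` (`le_bernsteinMean_abs_sub_half_sub`). Mixing radii `ρ = U^(1/a)/2`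
puts mass of order `n^(-a/2)` in that window, and both bounds become `n^(-(1+a)/2)`. The endpoint
rates come from a point mass and from the uniform law. -/

/-- `|f - g|` is the length of the half-open interval between the two values; Tonelli exchanges this
length with `π`. -/
theorem lintegral_abs_sub_eq_lintegral_measure_between {Ω : Type*} [MeasurableSpace Ω]
    (π : Measure Ω) [SFinite π] {f g : Ω → ℝ} (hf : Measurable f) (hg : Measurable g) :
    ∫⁻ ω, ENNReal.ofReal |f ω - g ω| ∂π =
      ∫⁻ x : ℝ, π {ω | (f ω ≤ x ∧ x < g ω) ∨ (g ω ≤ x ∧ x < f ω)} := by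
  set S : Set (Ω × ℝ) :=
    {z | (f z.1 ≤ z.2 ∧ z.2 < g z.1) ∨ (g z.1 ≤ z.2 ∧ z.2 < f z.1)} with hS
  have hf' : Measurable fun z : Ω × ℝ => f z.1 := hf.comp measurable_fst
  have hg' : Measurable fun z : Ω × ℝ => g z.1 := hg.comp measurable_fst
  have hSm : MeasurableSet S :=
    ((measurableSet_le hf' measurable_snd).inter (measurableSet_lt measurable_snd hg')).union
      ((measurableSet_le hg' measurable_snd).inter (measurableSet_lt measurable_snd hf'))
  have h1 := Measure.prod_apply (μ := π) (ν := (volume : Measure ℝ)) hSm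
  have h2 := Measure.prod_apply_symm (μ := π) (ν := (volume : Measure ℝ)) hSm
  rw [h1] at h2
  rw [show (∫⁻ x : ℝ, π {ω | (f ω ≤ x ∧ x < g ω) ∨ (g ω ≤ x ∧ x < f ω)}) =
    ∫⁻ y, π ((fun x => (x, y)) ⁻¹' S) from rfl, ← h2]
  refine lintegral_congr fun ω => ?_
  have : Prod.mk ω ⁻¹' S = Set.Ico (min (f ω) (g ω)) (max (f ω) (g ω)) := by
    ext x
    simp only [hS, Set.mem_preimage, Set.mem_ofPred_eq, Set.mem_Ico, min_le_iff, lt_max_iff]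
    constructor
    · rintro (h | h) <;> tauto
    · rintro ⟨h | h, h' | h'⟩
      · exact absurd h (not_le.2 h')
      · tauto
      · tauto
      · exact absurd h (not_le.2 h')
  rw [this, Real.volume_Ico, max_sub_min_eq_abs]
  rw [abs_sub_comm]

theorem wassersteinDist_map_le {Ω : Type*} [MeasurableSpace Ω] (P : Measure Ω) {f g : Ω → ℝ}
    (hf : Measurable f) (hg : Measurable g) :
    wassersteinDist (P.map f) (P.map g) ≤ ∫⁻ ω, ENNReal.ofReal |f ω - g ω| ∂P := by
  have hfg : Measurable fun ω => (f ω, g ω) := hf.prodMk hg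
  have hc : IsCoupling (P.map fun ω => (f ω, g ω)) (P.map f) (P.map g) := by
    constructor
    · rw [Measure.map_map measurable_fst hfg]; rfl
    · rw [Measure.map_map measurable_snd hfg]; rfl
  calc wassersteinDist (P.map f) (P.map g)
      ≤ ∫⁻ z, ENNReal.ofReal |z.1 - z.2| ∂(P.map fun ω => (f ω, g ω)) :=
        iInf_le_of_le _ (iInf_le _ hc)
    _ = _ := by rw [lintegral_map (by fun_prop) hfg]

/-- Under any coupling, the events `z.1 ≤ x` and `z.2 ≤ x` differ only when `x` separates the
coordinates. -/
theorem lintegral_abs_cdf_sub_le_wassersteinDist (μ ν : Measure ℝ) [IsProbabilityMeasure μ]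
    [IsProbabilityMeasure ν] :
    ∫⁻ x, ENNReal.ofReal |cdf μ x - cdf ν x| ≤ wassersteinDist μ ν := by
  refine le_iInf₂ fun π hπ => ?_
  have : IsProbabilityMeasure π := by
    constructor
    have := congrArg (fun m => m Set.univ) hπ.1
    simpa [Measure.map_apply measurable_fst] using this
  rw [lintegral_abs_sub_eq_lintegral_measure_between π measurable_fst measurable_snd]
  refine lintegral_mono fun x => ?_
  have h1 : cdf μ x = π.real {z | z.1 ≤ x} := by
    rw [cdf_eq_real, ← hπ.1, map_measureReal_apply measurable_fst measurableSet_Iic]; rfl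
  have h2 : cdf ν x = π.real {z | z.2 ≤ x} := by
    rw [cdf_eq_real, ← hπ.2, map_measureReal_apply measurable_snd measurableSet_Iic]; rfl
  rw [← ofReal_measureReal, h1, h2]
  apply ENNReal.ofReal_le_ofReal
  have key : ∀ {A B C : Set (ℝ × ℝ)}, A ⊆ B ∪ C → π.real A ≤ π.real B + π.real C := fun h =>
    (measureReal_mono h).trans (measureReal_union_le _ _)
  rw [abs_le]
  constructor
  · have := key (A := {z : ℝ × ℝ | z.2 ≤ x}) (B := {z | z.1 ≤ x})
      (C := {z | (z.1 ≤ x ∧ x < z.2) ∨ (z.2 ≤ x ∧ x < z.1)}) (by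
        intro z hz
        by_cases h : z.1 ≤ x
        · exact Or.inl h
        · exact Or.inr (Or.inr ⟨hz, not_le.1 h⟩))
    linarith
  · have := key (A := {z : ℝ × ℝ | z.1 ≤ x}) (B := {z | z.2 ≤ x})
      (C := {z | (z.1 ≤ x ∧ x < z.2) ∨ (z.2 ≤ x ∧ x < z.1)}) (by
        intro z hz
        by_cases h : z.2 ≤ x
        · exact Or.inl h
        · exact Or.inr (Or.inl ⟨hz, not_le.1 h⟩))
    linarith

/-! ### Quantile functions and the optimal coupling -/

open Classical in
/-- The quantile function of `μ` on `(0, 1)`, extended by `0`. -/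
noncomputable def quantile (μ : Measure ℝ) (u : ℝ) : ℝ :=
  if u ∈ Set.Ioo (0 : ℝ) 1 then sInf {x | u ≤ cdf μ x} else 0

/-- Right continuity of the distribution function makes the infimum attained; its limits at `±∞`
make the infimum genuine for `0 < u < 1`. -/
theorem quantile_le_iff (μ : Measure ℝ) {u : ℝ} (hu : u ∈ Set.Ioo (0 : ℝ) 1) (x : ℝ) :
    quantile μ u ≤ x ↔ u ≤ cdf μ x := by
  rw [quantile, if_pos hu]
  set S : Set ℝ := {x | u ≤ cdf μ x} with hS
  have hne : S.Nonempty := by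
    obtain ⟨y, hy⟩ := ((tendsto_cdf_atTop μ).eventually (eventually_ge_nhds hu.2)).exists
    exact ⟨y, hy⟩
  have hbdd : BddBelow S := by
    obtain ⟨y, hy⟩ := ((tendsto_cdf_atBot μ).eventually (eventually_lt_nhds hu.1)).exists
    refine ⟨y, fun z hz => ?_⟩
    by_contra h
    exact absurd (hz.trans (monotone_cdf μ (not_le.1 h).le)) (not_le.2 hy)
  constructor
  · intro h
    have hmem : u ≤ cdf μ (sInf S) := by
      have hc : Tendsto (cdf μ) (𝓝[>] (sInf S)) (𝓝 (cdf μ (sInf S))) :=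
        ((cdf μ).right_continuous (sInf S)).mono_left (nhdsWithin_mono _ Set.Ioi_subset_Ici_self)
      refine ge_of_tendsto hc ?_
      filter_upwards [self_mem_nhdsWithin] with y hy
      obtain ⟨s, hs, hsy⟩ := exists_lt_of_csInf_lt hne hy
      exact le_trans hs (monotone_cdf μ hsy.le)
    exact hmem.trans (monotone_cdf μ h)
  · exact fun h => csInf_le hbdd h

theorem measurable_quantile (μ : Measure ℝ) : Measurable (quantile μ) := by
  refine measurable_of_Iic fun x => ?_
  have : quantile μ ⁻¹' Set.Iic x = (Set.Ioo 0 1 ∩ Set.Iic (cdf μ x)) ∪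
      ((Set.Ioo 0 1)ᶜ ∩ {_u | (0 : ℝ) ≤ x}) := by
    ext u
    by_cases hu : u ∈ Set.Ioo (0 : ℝ) 1
    · simp only [Set.mem_preimage, Set.mem_Iic, quantile_le_iff μ hu]
      simp only [Set.mem_union, Set.mem_inter_iff, Set.mem_compl_iff, hu, Set.mem_Iic]
      tauto
    · simp only [Set.mem_preimage, Set.mem_Iic, quantile, if_neg hu]
      simp only [Set.mem_union, Set.mem_inter_iff, Set.mem_compl_iff, hu, Set.mem_ofPred_eq]
      tauto
  rw [this]
  exact (measurableSet_Ioo.inter measurableSet_Iic).union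
    (measurableSet_Ioo.compl.inter (MeasurableSet.const _))

theorem map_quantile (μ : Measure ℝ) [IsProbabilityMeasure μ] :
    (volume.restrict (Set.Ioo (0 : ℝ) 1)).map (quantile μ) = μ := by
  have : IsProbabilityMeasure (volume.restrict (Set.Ioo (0 : ℝ) 1)) := ⟨by simp⟩
  have := Measure.isProbabilityMeasure_map (μ := volume.restrict (Set.Ioo (0 : ℝ) 1))
    (measurable_quantile μ).aemeasurable
  refine Measure.ext_of_Iic _ _ fun x => ?_
  rw [Measure.map_apply (measurable_quantile μ) measurableSet_Iic,
    Measure.restrict_apply (measurable_quantile μ measurableSet_Iic)]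
  have h1 : quantile μ ⁻¹' Set.Iic x ∩ Set.Ioo 0 1 = Set.Ioo 0 1 ∩ Set.Iic (cdf μ x) := by
    ext u
    simp only [Set.mem_inter_iff, Set.mem_preimage, Set.mem_Iic]
    constructor
    · rintro ⟨h, hu⟩; exact ⟨hu, (quantile_le_iff μ hu x).1 h⟩
    · rintro ⟨hu, h⟩; exact ⟨(quantile_le_iff μ hu x).2 h, hu⟩
  rw [h1, ← ofReal_cdf]
  have h0 := cdf_nonneg μ x
  have hle := cdf_le_one μ x
  apply le_antisymm
  · calc volume (Set.Ioo 0 1 ∩ Set.Iic (cdf μ x)) ≤ volume (Set.Ioc 0 (cdf μ x)) :=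
          measure_mono fun u hu => ⟨hu.1.1, hu.2⟩
      _ = _ := by simp
  · calc ENNReal.ofReal (cdf μ x) = volume (Set.Ioo 0 (cdf μ x)) := by simp
      _ ≤ volume (Set.Ioo 0 1 ∩ Set.Iic (cdf μ x)) :=
        measure_mono fun u hu => ⟨⟨hu.1, hu.2.trans_le hle⟩, hu.2.le⟩

/-- The quantile coupling is optimal: `x` separates the two quantiles at level `u` only if `u` lies
between the two distribution functions at `x`. -/
theorem wassersteinDist_le_lintegral_abs_cdf_sub (μ ν : Measure ℝ) [IsProbabilityMeasure μ]
    [IsProbabilityMeasure ν] :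
    wassersteinDist μ ν ≤ ∫⁻ x, ENNReal.ofReal |cdf μ x - cdf ν x| := by
  set P := volume.restrict (Set.Ioo (0 : ℝ) 1) with hP
  have hm := measurable_quantile μ
  have hn := measurable_quantile ν
  have hW := wassersteinDist_map_le P hm hn
  rw [hP, map_quantile, map_quantile, ← hP] at hW
  refine hW.trans ?_
  rw [lintegral_abs_sub_eq_lintegral_measure_between P hm hn]
  refine lintegral_mono fun x => ?_
  rw [hP, Measure.restrict_apply']
  swap
  · exact measurableSet_Ioo
  have : {u | (quantile μ u ≤ x ∧ x < quantile ν u) ∨ (quantile ν u ≤ x ∧ x < quantile μ u)} ∩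
      Set.Ioo 0 1 ⊆ Set.Ioc (min (cdf μ x) (cdf ν x)) (max (cdf μ x) (cdf ν x)) := by
    rintro u ⟨h, hu⟩
    have hμ := quantile_le_iff μ hu x
    have hν := quantile_le_iff ν hu x
    simp only [Set.mem_ofPred_eq, ← not_le, hμ, hν] at h
    simp only [Set.mem_Ioc, le_max_iff, ← not_le, le_min_iff]
    tauto
  refine (measure_mono this).trans ?_
  rw [Real.volume_Ioc, max_sub_min_eq_abs, abs_sub_comm]

theorem wassersteinDist_eq_lintegral_abs_cdf_sub (μ ν : Measure ℝ) [IsProbabilityMeasure μ]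
    [IsProbabilityMeasure ν] :
    wassersteinDist μ ν = ∫⁻ x, ENNReal.ofReal |cdf μ x - cdf ν x| :=
  le_antisymm (wassersteinDist_le_lintegral_abs_cdf_sub μ ν)
    (lintegral_abs_cdf_sub_le_wassersteinDist μ ν)

theorem wassersteinDist_comm (μ ν : Measure ℝ) [IsProbabilityMeasure μ]
    [IsProbabilityMeasure ν] : wassersteinDist μ ν = wassersteinDist ν μ := by
  simp only [wassersteinDist_eq_lintegral_abs_cdf_sub, abs_sub_comm]

theorem measurable_cdf (μ : Measure ℝ) : Measurable fun x => cdf μ x :=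
  (monotone_cdf μ).measurable

theorem wassersteinDist_triangle (μ ν ρ : Measure ℝ) [IsProbabilityMeasure μ]
    [IsProbabilityMeasure ν] [IsProbabilityMeasure ρ] :
    wassersteinDist μ ρ ≤ wassersteinDist μ ν + wassersteinDist ν ρ := by
  simp only [wassersteinDist_eq_lintegral_abs_cdf_sub]
  have := measurable_cdf μ
  have := measurable_cdf ν
  rw [← lintegral_add_left (by fun_prop)]
  refine lintegral_mono fun x => ?_
  rw [← ENNReal.ofReal_add (abs_nonneg _) (abs_nonneg _)]
  exact ENNReal.ofReal_le_ofReal (abs_sub_le _ _ _)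

/-! ### Lipschitz test functions and duality -/

theorem lintegral_lipschitz_le_add_wassersteinDist (μ ν : Measure ℝ) {f : ℝ → ℝ}
    (hfm : Measurable f) {K : ℝ} (hK : 0 < K) (hf : ∀ x y, f x - f y ≤ K * |x - y|) :
    ∫⁻ x, ENNReal.ofReal (f x) ∂μ ≤
      ∫⁻ x, ENNReal.ofReal (f x) ∂ν + ENNReal.ofReal K * wassersteinDist μ ν := by
  rw [← tsub_le_iff_left, mul_comm]
  have hK0 : ENNReal.ofReal K ≠ 0 := by simpa using hK
  rw [← ENNReal.div_le_iff_le_mul (Or.inl hK0) (Or.inl ENNReal.ofReal_ne_top)]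
  refine le_iInf₂ fun π hπ => ?_
  rw [ENNReal.div_le_iff_le_mul (Or.inl hK0) (Or.inl ENNReal.ofReal_ne_top), tsub_le_iff_left,
    ← hπ.1, ← hπ.2, lintegral_map (by fun_prop) measurable_fst,
    lintegral_map (by fun_prop) measurable_snd, mul_comm, ← lintegral_const_mul _ (by fun_prop),
    ← lintegral_add_left (by fun_prop)]
  refine lintegral_mono fun z => ?_
  rw [← ENNReal.ofReal_mul hK.le]
  refine (ENNReal.ofReal_le_ofReal ?_).trans ENNReal.ofReal_add_le
  linarith [hf z.1 z.2]

/-- Integration by parts in the form of Fubini: on the support, the inner integrand is `s t` times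
the indicator of `x ≤ t`. -/
theorem integral_setIntegral_Icc_eq_setIntegral_mul_cdf (μ : Measure ℝ) [IsProbabilityMeasure μ]
    (hμ : ∀ᵐ x ∂μ, x ∈ Set.Icc (0 : ℝ) 1) {s : ℝ → ℝ} (hs : Measurable s) (hs1 : ∀ t, |s t| ≤ 1) :
    ∫ x, (∫ t in x..1, s t) ∂μ = ∫ t in Set.Icc (0 : ℝ) 1, s t * cdf μ t := by
  have h1 : ∀ᵐ x ∂μ, (∫ t in x..1, s t) =
      ∫ t in Set.Icc (0 : ℝ) 1, s t * (Set.Ici x).indicator 1 t := by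
    filter_upwards [hμ] with x hx
    rw [intervalIntegral.integral_of_le hx.2, ← integral_Icc_eq_integral_Ioc]
    have : (fun t => s t * (Set.Ici x).indicator 1 t) = (Set.Ici x).indicator s := by
      ext t
      by_cases ht : t ∈ Set.Ici x <;> simp [ht]
    rw [this, setIntegral_indicator measurableSet_Ici]
    congr 2
    ext t
    simp only [Set.mem_Icc, Set.mem_inter_iff, Set.mem_Ici]
    constructor
    · exact fun h => ⟨⟨hx.1.trans h.1, h.2⟩, h.1⟩
    · exact fun h => ⟨h.2, h.1.2⟩
  rw [integral_congr_ae h1, integral_integral_swap]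
  · refine setIntegral_congr_fun measurableSet_Icc fun t _ => ?_
    rw [integral_const_mul, cdf_eq_real, ← integral_indicator_one measurableSet_Iic]
    congr 1
  · have hm : Measurable fun z : ℝ × ℝ => s z.2 * (Set.Ici z.1).indicator (1 : ℝ → ℝ) z.2 := by
      have : (fun z : ℝ × ℝ => (Set.Ici z.1).indicator (1 : ℝ → ℝ) z.2) =
          {z : ℝ × ℝ | z.1 ≤ z.2}.indicator 1 := by
        ext z; simp [Set.indicator]
      refine (hs.comp measurable_snd).mul ?_
      rw [this]
      exact measurable_one.indicator (measurableSet_le measurable_fst measurable_snd)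
    refine Integrable.of_bound hm.aestronglyMeasurable 1 (ae_of_all _ fun z => ?_)
    simp only [Function.uncurry, norm_mul, Real.norm_eq_abs]
    refine mul_le_one₀ (hs1 _) (abs_nonneg _) ?_
    by_cases h : z.2 ∈ Set.Ici z.1 <;> simp [h]

theorem cdf_eq_zero_of_ae_mem_Icc {μ : Measure ℝ} [IsProbabilityMeasure μ]
    (hμ : ∀ᵐ x ∂μ, x ∈ Set.Icc (0 : ℝ) 1) {x : ℝ} (hx : x < 0) : cdf μ x = 0 := by
  rw [cdf_eq_real, measureReal_eq_zero_iff]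
  refine measure_mono_null (fun y hy => ?_) (ae_iff.1 hμ)
  exact fun h => absurd (h.1.trans hy) (not_le.2 hx)

theorem cdf_eq_one_of_ae_mem_Icc {μ : Measure ℝ} [IsProbabilityMeasure μ]
    (hμ : ∀ᵐ x ∂μ, x ∈ Set.Icc (0 : ℝ) 1) {x : ℝ} (hx : 1 < x) : cdf μ x = 1 := by
  rw [cdf_eq_real, measureReal_def, mem_ae_iff_prob_eq_one measurableSet_Iic |>.1, ENNReal.toReal_one]
  filter_upwards [hμ] with y hy using hy.2.trans hx.le

/-- Kantorovich–Rubinstein duality for measures carried by `[0, 1]`. -/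
theorem wassersteinDist_le_of_forall_lipschitz (μ ν : Measure ℝ) [IsProbabilityMeasure μ]
    [IsProbabilityMeasure ν] (hμ : ∀ᵐ x ∂μ, x ∈ Set.Icc (0 : ℝ) 1)
    (hν : ∀ᵐ x ∂ν, x ∈ Set.Icc (0 : ℝ) 1) {C : ℝ}
    (H : ∀ f : ℝ → ℝ, LipschitzWith 1 f → ∫ x, f x ∂μ - ∫ x, f x ∂ν ≤ C) :
    wassersteinDist μ ν ≤ ENNReal.ofReal C := by
  rw [wassersteinDist_eq_lintegral_abs_cdf_sub]
  have hF := measurable_cdf μ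
  have hG := measurable_cdf ν
  -- The extremal test function is a primitive of the sign of the difference of distribution
  -- functions.
  set s : ℝ → ℝ := fun t => if cdf ν t ≤ cdf μ t then 1 else -1 with hs
  have hsm : Measurable s :=
    Measurable.ite (measurableSet_le hG hF) measurable_const measurable_const
  have hs1 : ∀ t, |s t| ≤ 1 := fun t => by
    simp only [hs]; split_ifs <;> simp
  have hsi : ∀ a b, IntervalIntegrable s volume a b := fun a b =>
    (intervalIntegrable_const (c := (1 : ℝ))).mono_fun hsm.aestronglyMeasurable
      (ae_of_all _ fun t => by simpa using hs1 t)
  have hlip : LipschitzWith 1 fun x => ∫ t in x..1, s t := by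
    refine LipschitzWith.of_dist_le_mul fun x y => ?_
    rw [Real.dist_eq, ← intervalIntegral.integral_add_adjacent_intervals (hsi x y) (hsi y 1), add_sub_cancel_right]
    have := intervalIntegral.norm_integral_le_of_norm_le_const (a := x) (b := y) (C := 1) (f := s)
      fun t _ => by simpa using hs1 t
    simpa [Real.dist_eq, abs_sub_comm] using this
  have h := H _ hlip
  have hint : ∀ (ρ : Measure ℝ), IntegrableOn (fun t => s t * cdf ρ t) (Set.Icc 0 1) := fun ρ =>
    Integrable.of_bound (hsm.mul (measurable_cdf ρ)).aestronglyMeasurable 1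
      (ae_of_all _ fun t => by
        rw [norm_mul, Real.norm_eq_abs, Real.norm_eq_abs, abs_of_nonneg (cdf_nonneg ρ t)]
        exact mul_le_one₀ (hs1 t) (cdf_nonneg ρ t) (cdf_le_one ρ t))
  rw [integral_setIntegral_Icc_eq_setIntegral_mul_cdf μ hμ hsm hs1,
    integral_setIntegral_Icc_eq_setIntegral_mul_cdf ν hν hsm hs1,
    ← integral_sub (hint μ) (hint ν)] at h
  have habs : ∀ t, s t * cdf μ t - s t * cdf ν t = |cdf μ t - cdf ν t| := fun t => by
    simp only [hs]
    split_ifs with h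
    · rw [abs_of_nonneg (sub_nonneg.2 h)]; ring
    · rw [abs_of_neg (sub_neg.2 (not_le.1 h))]; ring
  have hi := (hint μ).sub (hint ν)
  simp only [Pi.sub_def] at hi
  simp only [habs] at h hi
  have hzero : ∀ x ∉ Set.Icc (0 : ℝ) 1, ENNReal.ofReal |cdf μ x - cdf ν x| = 0 := fun x hx => by
    rw [Set.mem_Icc, not_and_or, not_le, not_le] at hx
    rcases hx with hx | hx
    · simp [cdf_eq_zero_of_ae_mem_Icc hμ hx, cdf_eq_zero_of_ae_mem_Icc hν hx]
    · simp [cdf_eq_one_of_ae_mem_Icc hμ hx, cdf_eq_one_of_ae_mem_Icc hν hx]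
  rw [← setLIntegral_eq_of_support_subset (Function.support_subset_iff'.2 hzero),
    ← ofReal_integral_eq_lintegral_ofReal hi (ae_of_all _ fun t => abs_nonneg _)]
  exact ENNReal.ofReal_le_ofReal h

/-! ### Exchangeable sequences with values in `{0, 1}` -/

section Exchangeable

variable {Ω : Type*} [MeasurableSpace Ω] {P : Measure Ω} {X : ℕ → Ω → ℝ}

theorem IsExchangeableZeroOne.mem_Icc (hX : IsExchangeableZeroOne X P) (k : ℕ) (ω : Ω) :
    X k ω ∈ Set.Icc (0 : ℝ) 1 := by
  rcases hX.zero_or_one k ω with h | h <;> simp [h]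

theorem IsExchangeableZeroOne.measurable_empiricalMean (hX : IsExchangeableZeroOne X P) (n : ℕ) :
    Measurable (empiricalMean X n) :=
  (Finset.measurable_fun_sum _ fun k _ => hX.measurable k).div_const _

theorem IsExchangeableZeroOne.empiricalMean_mem_Icc (hX : IsExchangeableZeroOne X P) (n : ℕ)
    (ω : Ω) : empiricalMean X n ω ∈ Set.Icc (0 : ℝ) 1 := by
  refine ⟨div_nonneg (Finset.sum_nonneg fun k _ => (hX.mem_Icc k ω).1) n.cast_nonneg, ?_⟩
  refine div_le_one_of_le₀ ?_ n.cast_nonneg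
  calc ∑ k ∈ Finset.range n, X k ω ≤ ∑ k ∈ Finset.range n, (1 : ℝ) :=
        Finset.sum_le_sum fun k _ => (hX.mem_Icc k ω).2
    _ = n := by simp

theorem IsExchangeableZeroOne.exists_int_eq_sum (hX : IsExchangeableZeroOne X P) (n : ℕ)
    (ω : Ω) : ∃ z : ℤ, ∑ k ∈ Finset.range n, X k ω = z := by
  induction n with
  | zero => exact ⟨0, by simp⟩
  | succ n ih =>
    obtain ⟨z, hz⟩ := ih
    rcases hX.zero_or_one n ω with h | h
    · exact ⟨z, by rw [Finset.sum_range_succ, hz, h, add_zero]⟩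
    · exact ⟨z + 1, by rw [Finset.sum_range_succ, hz, h]; push_cast; ring⟩

theorem IsExchangeableZeroOne.integral_perm (hX : IsExchangeableZeroOne X P) {n : ℕ}
    (σ : Equiv.Perm (Fin n)) {g : (Fin n → ℝ) → ℝ} (hg : Measurable g) :
    ∫ ω, g (fun i => X (σ i) ω) ∂P = ∫ ω, g (fun i => X i ω) ∂P := by
  have h := congrArg (fun m => ∫ v, g v ∂m) (hX.exchangeable n σ)
  rwa [integral_map (measurable_pi_lambda _ fun i => hX.measurable _).aemeasurable
      hg.aestronglyMeasurable,
    integral_map (measurable_pi_lambda _ fun i => hX.measurable _).aemeasurable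
      hg.aestronglyMeasurable] at h

theorem IsExchangeableZeroOne.integral_eq (hX : IsExchangeableZeroOne X P) (i : ℕ) :
    ∫ ω, X i ω ∂P = ∫ ω, X 0 ω ∂P := by
  have h := hX.integral_perm (n := i + 1) (Equiv.swap 0 (Fin.last i)) (g := fun v => v 0)
    (measurable_pi_apply _)
  simpa using h

theorem IsExchangeableZeroOne.integral_mul_eq (hX : IsExchangeableZeroOne X P) {i j : ℕ}
    (hij : i ≠ j) : ∫ ω, X i ω * X j ω ∂P = ∫ ω, X 0 ω * X 1 ω ∂P := by
  let a : Fin (i + j + 2) := ⟨i, by omega⟩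
  let b : Fin (i + j + 2) := ⟨j, by omega⟩
  have hab : a ≠ b := fun h => hij (congrArg Fin.val h)
  set τ := Equiv.swap 0 a with hτ
  -- `τ` sends `0` to `i`; the second swap corrects the image of `1` to `j` without moving `i`.
  set σ : Equiv.Perm (Fin (i + j + 2)) := Equiv.swap (τ 1) b * τ with hσ
  have h0 : σ 0 = a := by
    rw [hσ, Equiv.Perm.mul_apply, hτ, Equiv.swap_apply_left]
    refine Equiv.swap_apply_of_ne_of_ne (fun h => ?_) hab
    have h2 : (Equiv.swap 0 a) 0 = (Equiv.swap 0 a) 1 := by rw [Equiv.swap_apply_left, ← h]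
    exact absurd ((Equiv.swap 0 a).injective h2) (by simp)
  have h1 : σ 1 = b := by rw [hσ, Equiv.Perm.mul_apply, Equiv.swap_apply_left]
  have h := hX.integral_perm σ (g := fun v => v 0 * v 1)
    ((measurable_pi_apply _).mul (measurable_pi_apply _))
  simp only [h0, h1] at h
  exact h

variable [IsProbabilityMeasure P]

theorem IsExchangeableZeroOne.integrable_mul (hX : IsExchangeableZeroOne X P) (i j : ℕ) :
    Integrable (fun ω => X i ω * X j ω) P := by
  refine Integrable.of_bound ((hX.measurable i).mul (hX.measurable j)).aestronglyMeasurable 1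
    (ae_of_all _ fun ω => ?_)
  have hi := hX.mem_Icc i ω
  have hj := hX.mem_Icc j ω
  rw [norm_mul, Real.norm_eq_abs, Real.norm_eq_abs, abs_of_nonneg hi.1, abs_of_nonneg hj.1]
  exact mul_le_one₀ hi.2 hj.1 hj.2

theorem IsExchangeableZeroOne.integrable (hX : IsExchangeableZeroOne X P) (i : ℕ) :
    Integrable (X i) P := by
  refine Integrable.of_bound (hX.measurable i).aestronglyMeasurable 1 (ae_of_all _ fun ω => ?_)
  have hi := hX.mem_Icc i ω
  rw [Real.norm_eq_abs, abs_of_nonneg hi.1]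
  exact hi.2

/-- All off-diagonal products have the same mean, and `X i ^ 2 = X i` settles the diagonal. -/
theorem IsExchangeableZeroOne.integral_sq_linear_combination (hX : IsExchangeableZeroOne X P)
    (N : ℕ) (a : ℕ → ℝ) :
    ∫ ω, (∑ i ∈ Finset.range N, a i * X i ω) ^ 2 ∂P =
      (∫ ω, X 0 ω * X 1 ω ∂P) * (∑ i ∈ Finset.range N, a i) ^ 2 +
      (∫ ω, X 0 ω ∂P - ∫ ω, X 0 ω * X 1 ω ∂P) * ∑ i ∈ Finset.range N, a i ^ 2 := by
  set c := ∫ ω, X 0 ω * X 1 ω ∂P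
  set e := ∫ ω, X 0 ω ∂P
  have hpair : ∀ i j, ∫ ω, X i ω * X j ω ∂P = c + if i = j then e - c else 0 := fun i j => by
    split_ifs with h
    · subst h
      rw [add_sub_cancel, show e = ∫ ω, X i ω ∂P from (hX.integral_eq i).symm]
      refine integral_congr_ae (ae_of_all _ fun ω => ?_)
      rcases hX.zero_or_one i ω with h | h <;> simp [h]
    · rw [hX.integral_mul_eq h, add_zero]
  have hexp : ∀ ω, (∑ i ∈ Finset.range N, a i * X i ω) ^ 2 =
      ∑ i ∈ Finset.range N, ∑ j ∈ Finset.range N, a i * a j * (X i ω * X j ω) := fun ω => by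
    rw [sq, Finset.sum_mul_sum]
    exact Finset.sum_congr rfl fun i _ => Finset.sum_congr rfl fun j _ => by ring
  simp only [hexp]
  rw [integral_finsetSum _ fun i _ => integrable_finsetSum _ fun j _ =>
    (hX.integrable_mul i j).const_mul _]
  have : ∀ i ∈ Finset.range N, ∫ ω, ∑ j ∈ Finset.range N, a i * a j * (X i ω * X j ω) ∂P =
      c * (a i * ∑ j ∈ Finset.range N, a j) + (e - c) * a i ^ 2 := fun i hi => by
    rw [integral_finsetSum _ fun j _ => (hX.integrable_mul i j).const_mul _]
    simp only [integral_const_mul, hpair, mul_add, Finset.sum_add_distrib, mul_ite, mul_zero,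
      Finset.sum_ite_eq, hi, if_true, Finset.mul_sum]
    congr 1
    · exact Finset.sum_congr rfl fun j _ => by ring
    · ring
  rw [Finset.sum_congr rfl this, Finset.sum_add_distrib, ← Finset.mul_sum, ← Finset.mul_sum,
    ← Finset.sum_mul]
  ring

/-- `Var(X₀) - Cov(X₀, X₁)`, the mean of the conditional variance given the directing variable. -/
noncomputable def idiosyncraticVariance (X : ℕ → Ω → ℝ) (P : Measure Ω) : ℝ :=
  ∫ ω, X 0 ω ∂P - ∫ ω, X 0 ω * X 1 ω ∂P

theorem IsExchangeableZeroOne.idiosyncraticVariance_le_one (hX : IsExchangeableZeroOne X P) :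
    idiosyncraticVariance X P ≤ 1 := by
  have h1 : ∫ ω, X 0 ω ∂P ≤ 1 := by
    calc ∫ ω, X 0 ω ∂P ≤ ∫ _, (1 : ℝ) ∂P :=
          integral_mono (hX.integrable 0) (integrable_const _) fun ω => (hX.mem_Icc 0 ω).2
      _ = 1 := by simp
  have h2 : 0 ≤ ∫ ω, X 0 ω * X 1 ω ∂P :=
    integral_nonneg fun ω => mul_nonneg (hX.mem_Icc 0 ω).1 (hX.mem_Icc 1 ω).1
  unfold idiosyncraticVariance
  linarith

/-- The coefficients of the difference sum to zero, so only the sum of their squares contributes. -/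
theorem IsExchangeableZeroOne.integral_empiricalMean_sub_sq (hX : IsExchangeableZeroOne X P)
    {n m : ℕ} (hn : 0 < n) (hnm : n ≤ m) :
    ∫ ω, (empiricalMean X n ω - empiricalMean X m ω) ^ 2 ∂P =
      idiosyncraticVariance X P * (1 / n - 1 / m) := by
  have hm : 0 < m := hn.trans_le hnm
  have hn' : (n : ℝ) ≠ 0 := by positivity
  have hm' : (m : ℝ) ≠ 0 := by positivity
  set a : ℕ → ℝ := fun i => (if i ∈ Finset.range n then (1 / n : ℝ) else 0) - 1 / m with ha
  have hsub : Finset.range m ∩ Finset.range n = Finset.range n :=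
    Finset.inter_eq_right.2 (Finset.range_mono hnm)
  have hcomb : ∀ ω, empiricalMean X n ω - empiricalMean X m ω =
      ∑ i ∈ Finset.range m, a i * X i ω := fun ω => by
    simp only [ha, sub_mul, ite_mul, zero_mul, Finset.sum_sub_distrib, Finset.sum_ite_mem, hsub,
      ← Finset.mul_sum, empiricalMean]
    ring
  have hsum : ∑ i ∈ Finset.range m, a i = 0 := by
    simp only [ha, Finset.sum_sub_distrib, Finset.sum_ite_mem, hsub]
    simp [hn', hm']
  have hsq : ∑ i ∈ Finset.range m, a i ^ 2 = 1 / n - 1 / m := by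
    have : ∀ i, a i ^ 2 = (if i ∈ Finset.range n then (1 / n * (1 / n) - 2 / n / m : ℝ) else 0) +
        1 / m * (1 / m) := fun i => by
      simp only [ha]; split_ifs <;> ring
    simp only [this, Finset.sum_add_distrib, Finset.sum_ite_mem, hsub]
    simp only [Finset.sum_const, Finset.card_range, nsmul_eq_mul]
    field_simp
    ring
  simp only [hcomb]
  rw [hX.integral_sq_linear_combination, hsum, hsq, idiosyncraticVariance]
  ring

theorem IsExchangeableZeroOne.integral_empiricalMean_mul_one_sub
    (hX : IsExchangeableZeroOne X P) {n : ℕ} (hn : 0 < n) :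
    ∫ ω, empiricalMean X n ω * (1 - empiricalMean X n ω) ∂P =
      idiosyncraticVariance X P * (1 - 1 / n) := by
  have hn' : (n : ℝ) ≠ 0 := by positivity
  have hmean : ∀ ω, empiricalMean X n ω = ∑ i ∈ Finset.range n, (1 / n : ℝ) * X i ω := fun ω => by
    rw [empiricalMean, ← Finset.mul_sum]; ring
  have h1 : ∫ ω, empiricalMean X n ω ∂P = ∫ ω, X 0 ω ∂P := by
    simp only [hmean]
    rw [integral_finsetSum _ fun i _ => (hX.integrable i).const_mul _]
    simp only [integral_const_mul, hX.integral_eq, Finset.sum_const, Finset.card_range,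
      nsmul_eq_mul]
    field_simp
  have h2 := hX.integral_sq_linear_combination n fun _ => (1 / n : ℝ)
  simp only [← hmean] at h2
  have hb : ∀ ω, ‖empiricalMean X n ω‖ ≤ 1 := fun ω => by
    have := hX.empiricalMean_mem_Icc n ω
    rw [Real.norm_eq_abs, abs_of_nonneg this.1]; exact this.2
  have hi1 : Integrable (empiricalMean X n) P :=
    Integrable.of_bound (hX.measurable_empiricalMean n).aestronglyMeasurable 1 (ae_of_all _ hb)
  have hi2 : Integrable (fun ω => empiricalMean X n ω ^ 2) P :=
    Integrable.of_bound ((hX.measurable_empiricalMean n).pow_const 2).aestronglyMeasurable 1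
      (ae_of_all _ fun ω => by rw [norm_pow]; exact pow_le_one₀ (norm_nonneg _) (hb ω))
  have : ∀ ω, empiricalMean X n ω * (1 - empiricalMean X n ω) =
      empiricalMean X n ω - empiricalMean X n ω ^ 2 := fun ω => by ring
  simp only [this]
  rw [integral_sub hi1 hi2, h1, h2, idiosyncraticVariance]
  simp only [Finset.sum_const, Finset.card_range, nsmul_eq_mul]
  field_simp
  ring

theorem IsExchangeableZeroOne.ae_eq_of_idiosyncraticVariance_nonpos
    (hX : IsExchangeableZeroOne X P) (h : idiosyncraticVariance X P ≤ 0) (k : ℕ) :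
    X k =ᵐ[P] X 0 := by
  rcases Nat.eq_zero_or_pos k with rfl | hk
  · rfl
  set a : ℕ → ℝ := fun i => if i = k then 1 else if i = 0 then -1 else 0 with ha
  have hcomb : ∀ (f : ℕ → ℝ), ∑ i ∈ Finset.range (k + 1), a i * f i = f k - f 0 := fun f => by
    rw [Finset.sum_range_succ, Finset.sum_eq_single_of_mem 0 (by simpa using hk)]
    · simp [ha, hk.ne]; ring
    · intro i hi hi0
      simp [ha, hi0, (Finset.mem_range.1 hi).ne]
  have h0 := hX.integral_sq_linear_combination (k + 1) a
  have hs : ∑ i ∈ Finset.range (k + 1), a i = 0 := by simpa using hcomb 1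
  rw [hs] at h0
  simp only [hcomb fun i => X i _] at h0
  have hle : ∫ ω, (X k ω - X 0 ω) ^ 2 ∂P ≤ 0 := by
    rw [h0]
    have := mul_nonneg (neg_nonneg.2 h) (Finset.sum_nonneg fun i (_ : i ∈ Finset.range (k + 1)) =>
      sq_nonneg (a i))
    unfold idiosyncraticVariance at this
    linarith
  have hint : Integrable (fun ω => (X k ω - X 0 ω) ^ 2) P := by
    have : (fun ω => (X k ω - X 0 ω) ^ 2) =
        fun ω => X k ω * X k ω - 2 * (X k ω * X 0 ω) + X 0 ω * X 0 ω := by ext; ring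
    rw [this]
    exact ((hX.integrable_mul _ _).sub ((hX.integrable_mul _ _).const_mul _)).add
      (hX.integrable_mul _ _)
  have hz := (integral_eq_zero_iff_of_nonneg (fun ω => sq_nonneg _) hint).1
    (le_antisymm hle (integral_nonneg fun ω => sq_nonneg _))
  filter_upwards [hz] with ω hω
  exact sub_eq_zero.1 (pow_eq_zero_iff two_ne_zero |>.1 hω)

theorem IsExchangeableZeroOne.wassersteinDist_empiricalMean_le (hX : IsExchangeableZeroOne X P)
    {n m : ℕ} (hn : 0 < n) (hnm : n ≤ m) :
    wassersteinDist (P.map (empiricalMean X n)) (P.map (empiricalMean X m)) ≤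
      ENNReal.ofReal (1 / √n) := by
  refine (wassersteinDist_map_le P (hX.measurable_empiricalMean n)
    (hX.measurable_empiricalMean m)).trans ?_
  have hb : ∀ ω, |empiricalMean X n ω - empiricalMean X m ω| ≤ 1 := fun ω => by
    have h1 := hX.empiricalMean_mem_Icc n ω
    have h2 := hX.empiricalMean_mem_Icc m ω
    rw [abs_le]; constructor <;> linarith [h1.1, h1.2, h2.1, h2.2]
  have hms := (hX.measurable_empiricalMean n).sub (hX.measurable_empiricalMean m)
  have hi1 : Integrable (fun ω => |empiricalMean X n ω - empiricalMean X m ω|) P :=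
    Integrable.of_bound hms.abs.aestronglyMeasurable 1 (ae_of_all _ fun ω => by simpa using hb ω)
  have hi2 : Integrable (fun ω => (empiricalMean X n ω - empiricalMean X m ω) ^ 2) P :=
    Integrable.of_bound (hms.pow_const 2).aestronglyMeasurable 1 (ae_of_all _ fun ω => by
      rw [norm_pow]; exact pow_le_one₀ (norm_nonneg _) (hb ω))
  rw [← ofReal_integral_eq_lintegral_ofReal hi1 (ae_of_all _ fun ω => abs_nonneg _)]
  apply ENNReal.ofReal_le_ofReal
  have hn' : (0 : ℝ) < n := by exact_mod_cast hn
  have hs : 0 < √(n : ℝ) := Real.sqrt_pos.2 hn'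
  have hss : √(n : ℝ) * √(n : ℝ) = n := Real.mul_self_sqrt hn'.le
  -- The arithmetic-geometric mean inequality, balanced at `|y| = 1/√n`, replaces Cauchy–Schwarz.
  have hpt : ∀ y : ℝ, |y| ≤ √n / 2 * y ^ 2 + 1 / (2 * √n) := fun y => by
    have : √n / 2 * y ^ 2 + 1 / (2 * √n) - |y| = (√n * |y| - 1) ^ 2 / (2 * √n) := by
      rw [← sq_abs y]; field_simp; ring
    have h2 : 0 ≤ (√n * |y| - 1) ^ 2 / (2 * √n) := by positivity
    linarith
  have hv : ∫ ω, (empiricalMean X n ω - empiricalMean X m ω) ^ 2 ∂P ≤ 1 / n := by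
    rw [hX.integral_empiricalMean_sub_sq hn hnm]
    have h1 := hX.idiosyncraticVariance_le_one
    have h2 : (0 : ℝ) ≤ 1 / n - 1 / m :=
      sub_nonneg.2 (one_div_le_one_div_of_le hn' (by exact_mod_cast hnm))
    have h3 : (0 : ℝ) ≤ 1 / m := by positivity
    nlinarith
  calc ∫ ω, |empiricalMean X n ω - empiricalMean X m ω| ∂P
      ≤ ∫ ω, (√n / 2 * (empiricalMean X n ω - empiricalMean X m ω) ^ 2 + 1 / (2 * √n)) ∂P :=
        integral_mono hi1 ((hi2.const_mul _).add (integrable_const _)) fun ω => hpt _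
    _ = √n / 2 * ∫ ω, (empiricalMean X n ω - empiricalMean X m ω) ^ 2 ∂P + 1 / (2 * √n) := by
        rw [integral_add (hi2.const_mul _) (integrable_const _), integral_const_mul]; simp
    _ ≤ √n / 2 * (1 / n) + 1 / (2 * √n) := by gcongr
    _ = 1 / √n := by
        rw [show (1 : ℝ) / n = 1 / (√n * √n) by rw [hss]]; field_simp; ring

end Exchangeable

/-! ### The possible rates -/

theorem abs_sub_round_sub_abs_sub_round_le (x y : ℝ) :
    |x - round x| - |y - round y| ≤ |x - y| := by
  have h1 := round_le x (round y)
  have h2 := abs_sub_le x y (round y)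
  linarith

theorem mul_one_sub_le_abs_sub_round {x : ℝ} (hx : x ∈ Set.Icc (0 : ℝ) 1) :
    x * (1 - x) ≤ |x - round x| := by
  obtain ⟨h0, h1⟩ := hx
  rcases le_or_gt (round x) 0 with h | h
  · have h' : ((round x : ℤ) : ℝ) ≤ 0 := by exact_mod_cast h
    have := le_abs_self (x - round x)
    nlinarith
  · have h' : (1 : ℝ) ≤ ((round x : ℤ) : ℝ) := by exact_mod_cast h
    have := neg_abs_le (x - round x)
    nlinarith

theorem measurable_abs_sub_round : Measurable fun x : ℝ => |x - round x| := by
  have : Measurable fun x : ℝ => ((round x : ℤ) : ℝ) := by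
    simp only [round_eq]
    exact (measurable_from_top (f := fun z : ℤ => (z : ℝ))).comp
      (Int.measurable_floor.comp (measurable_id.add_const _))
  exact (measurable_id.sub this).abs

section Rate

variable {Ω : Type*} [MeasurableSpace Ω] {P : Measure Ω} {X : ℕ → Ω → ℝ}
  [IsProbabilityMeasure P]

/-- `x ↦ dist(nx, ℤ)` is `n`-Lipschitz and vanishes at every value of the mean, which is an integer
over `n`. -/
theorem lintegral_dist_int_mul_le (hX : IsExchangeableZeroOne X P) (ν : Measure ℝ)
    [IsProbabilityMeasure ν] {n : ℕ} (hn : 0 < n) :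
    ∫⁻ x, ENNReal.ofReal |n * x - round (n * x)| ∂ν ≤
      n * wassersteinDist (P.map (empiricalMean X n)) ν := by
  have hn' : (0 : ℝ) < n := by exact_mod_cast hn
  have hm := hX.measurable_empiricalMean n
  have : IsProbabilityMeasure (P.map (empiricalMean X n)) :=
    Measure.isProbabilityMeasure_map hm.aemeasurable
  have hfm : Measurable fun x : ℝ => |n * x - round (n * x)| :=
    measurable_abs_sub_round.comp (measurable_const_mul (n : ℝ))
  have h := lintegral_lipschitz_le_add_wassersteinDist ν (P.map (empiricalMean X n)) hfm hn'
    fun x y => by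
      refine (abs_sub_round_sub_abs_sub_round_le _ _).trans ?_
      rw [← mul_sub, abs_mul, abs_of_pos hn']
  rw [lintegral_map (by fun_prop) hm, wassersteinDist_comm] at h
  have hz : ∀ ω, ENNReal.ofReal
      |n * empiricalMean X n ω - round (n * empiricalMean X n ω)| = 0 := fun ω => by
    obtain ⟨z, hz⟩ := hX.exists_int_eq_sum n ω
    rw [empiricalMean, mul_div_cancel₀ _ hn'.ne', hz, round_intCast]
    simp
  simpa [hz] using h

/-- Since `x = (n+1)x - nx`, the distance of `x` to `ℤ` is at most the sum of those of `(n+1)x` and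
`nx`. -/
theorem lintegral_dist_int_eq_zero (hX : IsExchangeableZeroOne X P) (ν : Measure ℝ)
    [IsProbabilityMeasure ν]
    (h : Tendsto (fun n : ℕ => n * wassersteinDist (P.map (empiricalMean X n)) ν) atTop (𝓝 0)) :
    ∫⁻ x, ENNReal.ofReal |x - round x| ∂ν = 0 := by
  have h2 := ((tendsto_add_atTop_iff_nat 1).2 h).add h
  rw [add_zero] at h2
  -- The left side does not depend on `n`, so a bound by a null sequence suffices.
  refine le_antisymm (ge_of_tendsto h2 ?_) zero_le
  filter_upwards [eventually_gt_atTop 0] with n hn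
  refine le_trans ?_ (add_le_add (lintegral_dist_int_mul_le hX ν n.succ_pos)
    (lintegral_dist_int_mul_le hX ν hn))
  have hfm : ∀ n : ℕ, Measurable fun x : ℝ => |n * x - round (n * x)| := fun n =>
    measurable_abs_sub_round.comp (measurable_const_mul (n : ℝ))
  have := hfm (n + 1)
  rw [← lintegral_add_left (by fun_prop)]
  refine lintegral_mono fun x => ?_
  rw [← ENNReal.ofReal_add (abs_nonneg _) (abs_nonneg _)]
  apply ENNReal.ofReal_le_ofReal
  refine (round_le x (round ((n + 1 : ℕ) * x) - round (n * x))).trans ?_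
  have : x - ((round ((n + 1 : ℕ) * x) - round (n * x) : ℤ) : ℝ) =
      ((n + 1 : ℕ) * x - round ((n + 1 : ℕ) * x)) - (n * x - round (n * x)) := by
    push_cast; ring
  rw [this]
  exact abs_sub _ _

theorem idiosyncraticVariance_nonpos (hX : IsExchangeableZeroOne X P) (ν : Measure ℝ)
    [IsProbabilityMeasure ν]
    (h : Tendsto (fun n : ℕ => n * wassersteinDist (P.map (empiricalMean X n)) ν) atTop (𝓝 0))
    (h' : Tendsto (fun n : ℕ => wassersteinDist (P.map (empiricalMean X n)) ν) atTop (𝓝 0)) :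
    idiosyncraticVariance X P ≤ 0 := by
  have hν := lintegral_dist_int_eq_zero hX ν h
  have hle : ∀ᶠ n : ℕ in atTop, ENNReal.ofReal (idiosyncraticVariance X P * (1 - 1 / n)) ≤
      wassersteinDist (P.map (empiricalMean X n)) ν := by
    filter_upwards [eventually_gt_atTop 0] with n hn
    have hm := hX.measurable_empiricalMean n
    have h1 := lintegral_lipschitz_le_add_wassersteinDist (P.map (empiricalMean X n)) ν
      measurable_abs_sub_round one_pos
      fun x y => by rw [one_mul]; exact abs_sub_round_sub_abs_sub_round_le x y
    rw [hν, zero_add, ENNReal.ofReal_one, one_mul] at h1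
    refine le_trans ?_ h1
    have := measurable_abs_sub_round
    rw [lintegral_map (by fun_prop) hm, ← hX.integral_empiricalMean_mul_one_sub hn,
      ofReal_integral_eq_lintegral_ofReal]
    · exact lintegral_mono fun ω => ENNReal.ofReal_le_ofReal
        (mul_one_sub_le_abs_sub_round (hX.empiricalMean_mem_Icc n ω))
    · refine Integrable.of_bound (hm.mul (hm.const_sub 1)).aestronglyMeasurable 1
        (ae_of_all _ fun ω => ?_)
      have := hX.empiricalMean_mem_Icc n ω
      rw [norm_mul, Real.norm_eq_abs, Real.norm_eq_abs, abs_of_nonneg this.1,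
        abs_of_nonneg (sub_nonneg.2 this.2)]
      exact mul_le_one₀ this.2 (sub_nonneg.2 this.2) (by linarith [this.1])
    · exact ae_of_all _ fun ω => mul_nonneg (hX.empiricalMean_mem_Icc n ω).1
        (sub_nonneg.2 (hX.empiricalMean_mem_Icc n ω).2)
  have hlim : Tendsto (fun n : ℕ => ENNReal.ofReal (idiosyncraticVariance X P * (1 - 1 / n)))
      atTop (𝓝 (ENNReal.ofReal (idiosyncraticVariance X P * (1 - 0)))) :=
    ENNReal.tendsto_ofReal ((tendsto_one_div_atTop_nhds_zero_nat.const_sub 1).const_mul _)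
  have := le_of_tendsto_of_tendsto hlim h' hle
  simpa using this

theorem wassersteinDist_empiricalMean_eq (hX : IsExchangeableZeroOne X P) (ν : Measure ℝ)
    (h : idiosyncraticVariance X P ≤ 0) {n : ℕ} (hn : 0 < n) :
    wassersteinDist (P.map (empiricalMean X n)) ν = wassersteinDist (P.map (X 0)) ν := by
  have hn' : (n : ℝ) ≠ 0 := by positivity
  rw [Measure.map_congr (f := empiricalMean X n) (g := X 0)]
  filter_upwards [ae_all_iff.2 (hX.ae_eq_of_idiosyncraticVariance_nonpos h)] with ω hω
  simp only [empiricalMean, hω, Finset.sum_const, Finset.card_range, nsmul_eq_mul]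
  field_simp

theorem rate_mem_Icc (hX : IsExchangeableZeroOne X P) (ν : Measure ℝ) [IsProbabilityMeasure ν]
    {δ : ℝ} (hδ : 0 < δ)
    (h : (fun n : ℕ => (wassersteinDist (P.map (empiricalMean X n)) ν).toReal)
      =Θ[atTop] fun n : ℕ => (n : ℝ) ^ (-δ)) :
    δ ∈ Set.Icc (1 / 2 : ℝ) 1 := by
  set D : ℕ → ℝ≥0∞ := fun n => wassersteinDist (P.map (empiricalMean X n)) ν with hD
  obtain ⟨hO, hO'⟩ := h
  obtain ⟨C, hC0, hC⟩ := hO.exists_pos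
  obtain ⟨c, hc0, hc⟩ := hO'.exists_pos
  rw [IsBigOWith] at hC hc
  have hpos : ∀ᶠ n : ℕ in atTop, 0 < (D n).toReal := by
    filter_upwards [hc, eventually_gt_atTop 0] with n hn hn0
    have hn' : (0 : ℝ) < n := by exact_mod_cast hn0
    have h1 : 0 < ‖(n : ℝ) ^ (-δ)‖ := norm_pos_iff.2 (Real.rpow_pos_of_pos hn' _).ne'
    by_contra h2
    have h3 : (D n).toReal = 0 := le_antisymm (not_lt.1 h2) ENNReal.toReal_nonneg
    simp only [hD] at h3
    rw [h3, norm_zero, mul_zero] at hn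
    exact absurd hn (not_le.2 h1)
  -- `toReal` sends `∞` to `0`, so positivity excludes an infinite distance.
  have hfin : ∀ᶠ n : ℕ in atTop, D n ≠ ∞ := by
    filter_upwards [hpos] with n hn h
    rw [h] at hn
    simp at hn
  have hub : ∀ᶠ n : ℕ in atTop, (D n).toReal ≤ C * (n : ℝ) ^ (-δ) := by
    filter_upwards [hC] with n hn
    rwa [Real.norm_of_nonneg ENNReal.toReal_nonneg,
      Real.norm_of_nonneg (Real.rpow_nonneg n.cast_nonneg _)] at hn
  have hlim : Tendsto (fun n => (D n).toReal) atTop (𝓝 0) := by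
    refine squeeze_zero' (Eventually.of_forall fun n => ENNReal.toReal_nonneg) hub ?_
    simpa using ((tendsto_rpow_neg_atTop hδ).comp tendsto_natCast_atTop_atTop).const_mul C
  constructor
  · by_contra! hlt
    -- Pass to `D n ≤ 1/√n + D m` and let `m → ∞` with `n` fixed.
    have hle : ∀ᶠ n : ℕ in atTop, (D n).toReal ≤ 1 / √n := by
      filter_upwards [eventually_gt_atTop 0] with n hn0
      have hl2 : Tendsto (fun m => 1 / √n + (D m).toReal) atTop (𝓝 (1 / √n + 0)) :=
        hlim.const_add _
      rw [add_zero] at hl2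
      refine ge_of_tendsto hl2 ?_
      filter_upwards [hfin, eventually_ge_atTop n] with m hm hnm
      have : ∀ k, IsProbabilityMeasure (P.map (empiricalMean X k)) := fun k =>
        Measure.isProbabilityMeasure_map (hX.measurable_empiricalMean k).aemeasurable
      have ht : D n ≤ ENNReal.ofReal (1 / √n) + D m :=
        (wassersteinDist_triangle _ (P.map (empiricalMean X m)) _).trans
          (add_le_add_left (hX.wassersteinDist_empiricalMean_le hn0 hnm) _)
      have := ENNReal.toReal_mono (ENNReal.add_ne_top.2 ⟨ENNReal.ofReal_ne_top, hm⟩) ht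
      rwa [ENNReal.toReal_add ENNReal.ofReal_ne_top hm,
        ENNReal.toReal_ofReal (by positivity)] at this
    have hgrow : Tendsto (fun n : ℕ => (n : ℝ) ^ (1 / 2 - δ)) atTop atTop :=
      (tendsto_rpow_atTop (sub_pos.2 hlt)).comp tendsto_natCast_atTop_atTop
    obtain ⟨n, h1, h2, h3, h4⟩ := (hle.and (hc.and ((hgrow.eventually_gt_atTop c).and
      (eventually_gt_atTop 0)))).exists
    have hn' : (0 : ℝ) < n := by exact_mod_cast h4
    rw [Real.norm_of_nonneg ENNReal.toReal_nonneg,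
      Real.norm_of_nonneg (Real.rpow_nonneg n.cast_nonneg _)] at h2
    have h5 : (n : ℝ) ^ (-δ) ≤ c * (n : ℝ) ^ (-(1 / 2) : ℝ) := by
      refine h2.trans (mul_le_mul_of_nonneg_left (h1.trans_eq ?_) hc0.le)
      rw [Real.rpow_neg hn'.le, ← Real.sqrt_eq_rpow, one_div]
    have h6 : (n : ℝ) ^ (1 / 2 - δ) = (n : ℝ) ^ (-δ) * (n : ℝ) ^ (1 / 2 : ℝ) := by
      rw [← Real.rpow_add hn']; congr 1; ring
    have h7 : (n : ℝ) ^ (-(1 / 2) : ℝ) * (n : ℝ) ^ (1 / 2 : ℝ) = 1 := by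
      rw [← Real.rpow_add hn']; simp
    have h8 := mul_le_mul_of_nonneg_right h5 (Real.rpow_nonneg hn'.le (1 / 2))
    rw [← h6, mul_assoc, h7, mul_one] at h8
    exact absurd h3 (not_lt.2 h8)
  · by_contra! hgt
    have hD0 : Tendsto D atTop (𝓝 0) := by
      rw [← ENNReal.ofReal_zero]
      refine (ENNReal.tendsto_ofReal hlim).congr' ?_
      filter_upwards [hfin] with n hn using ENNReal.ofReal_toReal hn
    have hnD : Tendsto (fun n : ℕ => n * D n) atTop (𝓝 0) := by
      have hr : Tendsto (fun n : ℕ => n * (D n).toReal) atTop (𝓝 0) := by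
        have hz : Tendsto (fun n : ℕ => C * (n : ℝ) ^ (-(δ - 1))) atTop (𝓝 0) := by
          simpa using ((tendsto_rpow_neg_atTop (sub_pos.2 hgt)).comp
            tendsto_natCast_atTop_atTop).const_mul C
        refine squeeze_zero' (Eventually.of_forall fun n =>
          mul_nonneg n.cast_nonneg ENNReal.toReal_nonneg) ?_ hz
        filter_upwards [hub, eventually_gt_atTop 0] with n hn hn0
        have hn' : (0 : ℝ) < n := by exact_mod_cast hn0
        calc (n : ℝ) * (D n).toReal ≤ n * (C * (n : ℝ) ^ (-δ)) := by gcongr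
          _ = C * ((n : ℝ) ^ (1 : ℝ) * (n : ℝ) ^ (-δ)) := by rw [Real.rpow_one]; ring
          _ = C * (n : ℝ) ^ (-(δ - 1)) := by
            rw [← Real.rpow_add hn']; congr 2; ring
      rw [← ENNReal.ofReal_zero]
      refine (ENNReal.tendsto_ofReal hr).congr' ?_
      filter_upwards [hfin] with n hn
      rw [ENNReal.ofReal_mul n.cast_nonneg, ENNReal.ofReal_toReal hn, ENNReal.ofReal_natCast]
    have hv := idiosyncraticVariance_nonpos hX ν hnD hD0
    have hconst : ∀ᶠ n : ℕ in atTop, (D n).toReal = (wassersteinDist (P.map (X 0)) ν).toReal := by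
      filter_upwards [eventually_gt_atTop 0] with n hn
      rw [← wassersteinDist_empiricalMean_eq hX ν hv hn]
    -- An eventually constant sequence with limit zero is eventually zero, contradicting `hpos`.
    have hz := tendsto_nhds_unique (hlim.congr' hconst) tendsto_const_nhds
    obtain ⟨n, h1, h2⟩ := (hpos.and hconst).exists
    rw [h2, ← hz] at h1
    exact lt_irrefl _ h1

end Rate

/-! ### Means of functions of a binomial variable -/

/-- The mean of `h S`, where `S` has the binomial distribution with parameters `n` and `p`. -/
noncomputable def binomialMean (p : ℝ) : ℕ → (ℕ → ℝ) → ℝ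
  | 0, h => h 0
  | n + 1, h => p * binomialMean p n (fun k => h (k + 1)) + (1 - p) * binomialMean p n h

theorem binomialMean_add (p : ℝ) (n : ℕ) (g h : ℕ → ℝ) :
    binomialMean p n (fun k => g k + h k) = binomialMean p n g + binomialMean p n h := by
  induction n generalizing g h with
  | zero => rfl
  | succ n ih => simp only [binomialMean, ih]; ring

theorem binomialMean_const_mul (p : ℝ) (n : ℕ) (c : ℝ) (h : ℕ → ℝ) :
    binomialMean p n (fun k => c * h k) = c * binomialMean p n h := by
  induction n generalizing h with
  | zero => rfl
  | succ n ih => simp only [binomialMean, ih]; ring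

theorem binomialMean_const (p : ℝ) (n : ℕ) (c : ℝ) : binomialMean p n (fun _ => c) = c := by
  induction n with
  | zero => rfl
  | succ n ih => simp only [binomialMean, ih]; ring

theorem binomialMean_sub (p : ℝ) (n : ℕ) (g h : ℕ → ℝ) :
    binomialMean p n (fun k => g k - h k) = binomialMean p n g - binomialMean p n h := by
  induction n generalizing g h with
  | zero => rfl
  | succ n ih => simp only [binomialMean, ih]; ring

/-- Averaging over one trial inside the argument lets the moments below follow by induction on `n`.
-/
theorem binomialMean_succ (p : ℝ) (n : ℕ) (h : ℕ → ℝ) :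
    binomialMean p (n + 1) h = binomialMean p n (fun k => p * h (k + 1) + (1 - p) * h k) := by
  rw [binomialMean_add, binomialMean_const_mul, binomialMean_const_mul]; rfl

theorem binomialMean_mono {p : ℝ} (hp : p ∈ Set.Icc (0 : ℝ) 1) {n : ℕ} {g h : ℕ → ℝ}
    (hgh : ∀ k ≤ n, g k ≤ h k) : binomialMean p n g ≤ binomialMean p n h := by
  induction n generalizing g h with
  | zero => exact hgh 0 le_rfl
  | succ n ih =>
    exact add_le_add
      (mul_le_mul_of_nonneg_left (ih fun k hk => hgh _ (by omega)) hp.1)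
      (mul_le_mul_of_nonneg_left (ih fun k hk => hgh _ (by omega)) (sub_nonneg.2 hp.2))

theorem abs_binomialMean_sub_le {p : ℝ} (hp : p ∈ Set.Icc (0 : ℝ) 1) {n : ℕ} {g h b : ℕ → ℝ}
    (hgh : ∀ k ≤ n, |g k - h k| ≤ b k) :
    |binomialMean p n g - binomialMean p n h| ≤ binomialMean p n b := by
  rw [← binomialMean_sub, abs_le]
  constructor
  · rw [neg_eq_neg_one_mul, ← binomialMean_const_mul]
    exact binomialMean_mono hp fun k hk => by
      have := neg_le_of_abs_le (hgh k hk); linarith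
  · exact binomialMean_mono hp fun k hk => le_of_abs_le (hgh k hk)

theorem continuous_binomialMean (n : ℕ) (h : ℕ → ℝ) :
    Continuous fun p => binomialMean p n h := by
  induction n generalizing h with
  | zero => exact continuous_const
  | succ n ih =>
    exact (continuous_id.mul (ih _)).add ((continuous_const.sub continuous_id).mul (ih _))

theorem hasDerivAt_binomialMean (n : ℕ) (h : ℕ → ℝ) (p : ℝ) :
    HasDerivAt (fun p => binomialMean p (n + 1) h)
      ((n + 1) * binomialMean p n (fun k => h (k + 1) - h k)) p := by
  induction n generalizing h with
  | zero =>
    have := ((hasDerivAt_id p).mul_const (h 1)).add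
      (((hasDerivAt_id p).const_sub 1).mul_const (h 0))
    refine HasDerivAt.congr_deriv (f := fun p => binomialMean p 1 h) this ?_
    simp only [binomialMean, Nat.cast_zero]
    ring
  | succ n ih =>
    have := ((hasDerivAt_id p).mul (ih fun k => h (k + 1))).add
      (((hasDerivAt_id p).const_sub 1).mul (ih h))
    refine HasDerivAt.congr_deriv (f := fun p => binomialMean p (n + 2) h) this ?_
    have h1 : binomialMean p (n + 1) (fun k => h (k + 1) - h k) =
      p * binomialMean p n (fun k => h (k + 1 + 1) - h (k + 1)) +
        (1 - p) * binomialMean p n (fun k => h (k + 1) - h k) := rfl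
    have h2 := binomialMean_sub p (n + 1) (fun k => h (k + 1)) h
    push_cast
    -- Of the `n + 2` copies of the mean difference, one comes from differentiating the weights `p`
    -- and `1 - p`; the other `n + 1` unfold by the recursion.
    rw [add_mul (n + 1 : ℝ) 1, one_mul]
    nth_rewrite 2 [h2]
    rw [h1]
    simp only [id]
    ring

theorem binomialMean_centered (p : ℝ) (n : ℕ) : binomialMean p n (fun k => k - n * p) = 0 := by
  induction n with
  | zero => simp [binomialMean]
  | succ n ih =>
    rw [binomialMean_succ, ← ih]
    congr 1; ext k; push_cast; ring

theorem binomialMean_centered_sq (p : ℝ) (n : ℕ) :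
    binomialMean p n (fun k => (k - n * p) ^ 2) = n * (p * (1 - p)) := by
  induction n with
  | zero => simp [binomialMean]
  | succ n ih =>
    have : (fun k : ℕ => p * (((k + 1 : ℕ) : ℝ) - (n + 1 : ℕ) * p) ^ 2 +
        (1 - p) * ((k : ℝ) - (n + 1 : ℕ) * p) ^ 2) =
        fun k : ℕ => ((k : ℝ) - n * p) ^ 2 + p * (1 - p) := by
      ext k; push_cast; ring
    rw [binomialMean_succ, this, binomialMean_add, ih, binomialMean_const]
    push_cast; ring

theorem binomialMean_centered_pow_four_le {p : ℝ} (hp : p ∈ Set.Icc (0 : ℝ) 1) (n : ℕ) :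
    binomialMean p n (fun k => (k - n * p) ^ 4) ≤ n ^ 2 := by
  induction n with
  | zero => simp [binomialMean]
  | succ n ih =>
    have : (fun k : ℕ => p * (((k + 1 : ℕ) : ℝ) - (n + 1 : ℕ) * p) ^ 4 +
        (1 - p) * ((k : ℝ) - (n + 1 : ℕ) * p) ^ 4) =
        fun k : ℕ => ((((k : ℝ) - n * p) ^ 4 + 6 * (p * (1 - p)) * ((k : ℝ) - n * p) ^ 2) +
          4 * (p * (1 - p)) * (1 - 2 * p) * ((k : ℝ) - n * p)) +
          p * (1 - p) * (1 - 3 * (p * (1 - p))) := by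
      ext k; push_cast; ring
    rw [binomialMean_succ, this, binomialMean_add, binomialMean_add, binomialMean_add,
      binomialMean_const_mul, binomialMean_const_mul, binomialMean_const,
      binomialMean_centered, binomialMean_centered_sq]
    have hq0 : 0 ≤ p * (1 - p) := mul_nonneg hp.1 (sub_nonneg.2 hp.2)
    have hq1 : p * (1 - p) ≤ 1 / 4 := by nlinarith [sq_nonneg (p - 1 / 2)]
    set v := p * (1 - p)
    have hn : (0 : ℝ) ≤ n := n.cast_nonneg
    have h1 : v * v ≤ 1 / 16 := by nlinarith
    have h2 : n * (v * v) ≤ n * (1 / 16) := mul_le_mul_of_nonneg_left h1 hn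
    push_cast
    nlinarith

/-! ### Bernstein operators on Lipschitz functions -/

/-- The Bernstein operator: the mean of `f (S / n)` for a binomial variable `S`. -/
noncomputable def bernsteinMean (n : ℕ) (f : ℝ → ℝ) (p : ℝ) : ℝ :=
  binomialMean p n fun k => f (k / n)

theorem bernsteinMean_sq {n : ℕ} (hn : 0 < n) (p : ℝ) :
    binomialMean p n (fun k => ((k : ℝ) / n - p) ^ 2) = p * (1 - p) / n := by
  have hn' : (n : ℝ) ≠ 0 := by positivity
  have : (fun k : ℕ => ((k : ℝ) / n - p) ^ 2) =
      fun k : ℕ => 1 / (n : ℝ) ^ 2 * ((k : ℝ) - n * p) ^ 2 := by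
    ext k; field_simp
  rw [this, binomialMean_const_mul, binomialMean_centered_sq]
  field_simp

theorem bernsteinMean_pow_four_le {n : ℕ} (hn : 0 < n) {p : ℝ} (hp : p ∈ Set.Icc (0 : ℝ) 1) :
    binomialMean p n (fun k => ((k : ℝ) / n - p) ^ 4) ≤ 1 / (n : ℝ) ^ 2 := by
  have hn' : (n : ℝ) ≠ 0 := by positivity
  have : (fun k : ℕ => ((k : ℝ) / n - p) ^ 4) =
      fun k : ℕ => 1 / (n : ℝ) ^ 4 * ((k : ℝ) - n * p) ^ 4 := by
    ext k; field_simp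
  rw [this, binomialMean_const_mul]
  calc 1 / (n : ℝ) ^ 4 * binomialMean p n (fun k => ((k : ℝ) - n * p) ^ 4)
      ≤ 1 / (n : ℝ) ^ 4 * n ^ 2 :=
        mul_le_mul_of_nonneg_left (binomialMean_centered_pow_four_le hp n) (by positivity)
    _ = _ := by field_simp

theorem variance_le_quarter (p : ℝ) : p * (1 - p) ≤ 1 / 4 := by
  nlinarith [sq_nonneg (p - 1 / 2)]

theorem abs_sub_le_of_lipschitzWith_one {f : ℝ → ℝ} (hf : LipschitzWith 1 f) (x y : ℝ) :
    |f x - f y| ≤ |x - y| := by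
  have := hf.dist_le_mul x y
  rwa [NNReal.coe_one, one_mul, Real.dist_eq, Real.dist_eq] at this

theorem abs_bernsteinMean_sub_le {f : ℝ → ℝ} (hf : LipschitzWith 1 f) {n : ℕ} (hn : 0 < n) {p : ℝ}
    (hp : p ∈ Set.Icc (0 : ℝ) 1) : |bernsteinMean n f p - f p| ≤ 1 / √n := by
  have hn' : (0 : ℝ) < n := by exact_mod_cast hn
  have hs : 0 < √(n : ℝ) := Real.sqrt_pos.2 hn'
  have hss : √(n : ℝ) * √(n : ℝ) = n := Real.mul_self_sqrt hn'.le
  have hpt : ∀ y : ℝ, |y| ≤ √n / 2 * y ^ 2 + 1 / (2 * √n) := fun y => by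
    have : √n / 2 * y ^ 2 + 1 / (2 * √n) - |y| = (√n * |y| - 1) ^ 2 / (2 * √n) := by
      rw [← sq_abs y]; field_simp; ring
    have h2 : 0 ≤ (√n * |y| - 1) ^ 2 / (2 * √n) := by positivity
    linarith
  have h := abs_binomialMean_sub_le hp (n := n) (g := fun k => f (k / n)) (h := fun _ => f p)
    (b := fun k => √n / 2 * ((k : ℝ) / n - p) ^ 2 + 1 / (2 * √n))
    fun k _ => (abs_sub_le_of_lipschitzWith_one hf _ _).trans (hpt _)
  rw [binomialMean_const, binomialMean_add, binomialMean_const_mul, binomialMean_const,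
    bernsteinMean_sq hn] at h
  refine h.trans ?_
  have h4 : p * (1 - p) / n ≤ 1 / (√n * √n) := by
    rw [hss]; gcongr; linarith [variance_le_quarter p]
  calc √n / 2 * (p * (1 - p) / n) + 1 / (2 * √n) ≤ √n / 2 * (1 / (√n * √n)) + 1 / (2 * √n) := by
        gcongr
    _ = 1 / √n := by field_simp; ring

theorem abs_integral_sub_mul_le {f : ℝ → ℝ} (hf : LipschitzWith 1 f) (x y z : ℝ)
    (M : ℝ) (hM : ∀ t ∈ Set.uIcc x y, |t - z| ≤ M) :
    |(∫ t in x..y, f t) - f z * (y - x)| ≤ M * |y - x| := by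
  have h1 : (∫ t in x..y, f t) - f z * (y - x) = ∫ t in x..y, (f t - f z) := by
    rw [intervalIntegral.integral_sub (hf.continuous.intervalIntegrable _ _)
      intervalIntegrable_const, intervalIntegral.integral_const, smul_eq_mul, mul_comm]
  rw [h1]
  refine intervalIntegral.norm_integral_le_of_norm_le_const (f := fun t => f t - f z)
    fun t ht => ?_
  exact (abs_sub_le_of_lipschitzWith_one hf t z).trans (hM t (Set.uIoc_subset_uIcc ht))

/-- A primitive of a Lipschitz function has a quadratic Taylor remainder; the linear term has mean
zero, leaving the variance. -/
theorem abs_bernsteinMean_primitive_sub_le {f : ℝ → ℝ} (hf : LipschitzWith 1 f) {n : ℕ}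
    (hn : 0 < n) {p : ℝ} (hp : p ∈ Set.Icc (0 : ℝ) 1) :
    |bernsteinMean n (fun x => ∫ t in (0 : ℝ)..x, f t) p - ∫ t in (0 : ℝ)..p, f t| ≤
      1 / (4 * n) := by
  have hn' : (n : ℝ) ≠ 0 := by positivity
  have hi : ∀ a b, IntervalIntegrable f volume a b := fun a b =>
    hf.continuous.intervalIntegrable _ _
  have hlin : binomialMean p n (fun k => (∫ t in (0 : ℝ)..p, f t) + f p / n * (k - n * p)) =
      ∫ t in (0 : ℝ)..p, f t := by
    rw [binomialMean_add, binomialMean_const_mul, binomialMean_const, binomialMean_centered,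
      mul_zero, add_zero]
  have h := abs_binomialMean_sub_le hp (n := n) (g := fun k => ∫ t in (0 : ℝ)..(k / n : ℝ), f t)
    (h := fun k => (∫ t in (0 : ℝ)..p, f t) + f p / n * (k - n * p))
    (b := fun k => ((k : ℝ) / n - p) ^ 2) fun k _ => by
      have h1 := abs_integral_sub_mul_le hf p (k / n) p |(k : ℝ) / n - p| fun t ht =>
        Set.abs_sub_left_of_mem_uIcc ht
      have h2 := intervalIntegral.integral_add_adjacent_intervals (hi 0 p) (hi p (k / n))
      rw [abs_mul_abs_self, ← sq] at h1
      convert h1 using 2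
      rw [← h2]
      field_simp
      ring
  rw [hlin, bernsteinMean_sq hn] at h
  refine h.trans ?_
  rw [div_le_div_iff₀ (by positivity) (by positivity)]
  have h3 := variance_le_quarter p
  have h4 : (0 : ℝ) ≤ n := n.cast_nonneg
  nlinarith [mul_le_mul_of_nonneg_right h3 h4]

/-- Let `F` be a primitive of `f`. The derivative of the Bernstein polynomial of `F` of degree `n +
1` is, up to `1/(n+1)`, that of `f` of degree `n`, so integration leaves only the errors for `F` at
the endpoints, which are `O(1/n)`. -/
theorem abs_integral_bernsteinMean_sub_le {f : ℝ → ℝ} (hf : LipschitzWith 1 f) {n : ℕ}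
    (hn : 0 < n) {α β : ℝ} (hα : 0 ≤ α) (hαβ : α ≤ β) (hβ : β ≤ 1) :
    |∫ p in α..β, (bernsteinMean n f p - f p)| ≤ 2 / n := by
  have hn' : (0 : ℝ) < n := by exact_mod_cast hn
  have hn1 : ((n + 1 : ℕ) : ℝ) = n + 1 := by push_cast; ring
  have hi : ∀ a b, IntervalIntegrable f volume a b := fun a b =>
    hf.continuous.intervalIntegrable _ _
  set F : ℝ → ℝ := fun x => ∫ t in (0 : ℝ)..x, f t with hF
  set D : ℝ → ℝ := fun p => (n + 1) * binomialMean p n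
    (fun k => F (((k + 1 : ℕ) : ℝ) / (n + 1 : ℕ)) - F ((k : ℝ) / (n + 1 : ℕ))) with hD
  have hDc : Continuous D := continuous_const.mul (continuous_binomialMean _ _)
  have hBc : Continuous (bernsteinMean n f) := continuous_binomialMean _ _
  have hDint : ∫ p in α..β, D p = bernsteinMean (n + 1) F β - bernsteinMean (n + 1) F α :=
    intervalIntegral.integral_eq_sub_of_hasDerivAt
      (fun p _ => hasDerivAt_binomialMean n (fun k => F ((k : ℝ) / (n + 1 : ℕ))) p)
      (hDc.intervalIntegrable _ _)
  have hfint : ∫ p in α..β, f p = F β - F α := by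
    rw [hF, eq_sub_iff_add_eq']
    exact intervalIntegral.integral_add_adjacent_intervals (hi _ _) (hi _ _)
  have hBD : ∀ p ∈ Set.Icc (0 : ℝ) 1, |bernsteinMean n f p - D p| ≤ 1 / (n + 1) := fun p hp => by
    simp only [hD, ← binomialMean_const_mul]
    refine (abs_binomialMean_sub_le hp (b := fun _ => 1 / ((n : ℝ) + 1)) fun k hk => ?_).trans_eq
      (binomialMean_const _ _ _)
    have hk' : (k : ℝ) ≤ n := by exact_mod_cast hk
    -- `k / n` lies in the cell `[k/(n+1), (k+1)/(n+1)]` over which `D` averages `f`.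
    have hlo : (k : ℝ) / (n + 1) ≤ k / n := by gcongr; linarith
    have hhi : (k : ℝ) / n ≤ (k + 1) / (n + 1) := by
      rw [div_le_div_iff₀ hn' (by positivity)]; nlinarith
    have hgap : ((k : ℝ) + 1) / (n + 1) - k / (n + 1) = 1 / (n + 1) := by ring
    have h1 := abs_integral_sub_mul_le hf ((k : ℝ) / (n + 1)) ((k + 1) / (n + 1)) (k / n)
      (1 / (n + 1)) fun t ht => by
        rw [Set.uIcc_of_le (hlo.trans hhi)] at ht
        rw [abs_le]
        constructor <;> linarith [ht.1, ht.2]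
    have h2 := intervalIntegral.integral_add_adjacent_intervals (hi 0 (k / (n + 1)))
      (hi ((k : ℝ) / (n + 1)) ((k + 1) / (n + 1)))
    have h3 : F ((k + 1) / (n + 1)) - F (k / (n + 1)) =
      ∫ t in ((k : ℝ) / (n + 1))..((k + 1) / (n + 1)), f t := by
        simp only [hF, ← h2]; ring
    rw [hn1]
    push_cast
    rw [h3]
    rw [hgap] at h1
    set I := ∫ t in ((k : ℝ) / (n + 1))..((k + 1) / (n + 1)), f t
    have h5 : (f (k / n) - (n + 1) * I) = -((n + 1) * (I - f (k / n) * (1 / (n + 1)))) := by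
      field_simp; ring
    have h6 : (0 : ℝ) < n + 1 := by positivity
    rw [h5, abs_neg, abs_mul, abs_of_pos h6]
    calc ((n : ℝ) + 1) * |I - f (k / n) * (1 / (n + 1))|
        ≤ (n + 1) * (1 / (n + 1) * |1 / ((n : ℝ) + 1)|) := by gcongr
      _ = 1 / (n + 1) := by rw [abs_of_pos (by positivity)]; field_simp
  have h1 : |∫ p in α..β, (bernsteinMean n f p - D p)| ≤ 1 / (n + 1) * |β - α| :=
    intervalIntegral.norm_integral_le_of_norm_le_const (C := 1 / ((n : ℝ) + 1))
      (f := fun p => bernsteinMean n f p - D p) fun p hp => by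
      rw [Set.uIoc_of_le hαβ] at hp
      exact hBD p ⟨hα.trans hp.1.le, hp.2.trans hβ⟩
  rw [intervalIntegral.integral_sub (hBc.intervalIntegrable _ _) (hDc.intervalIntegrable _ _),
    hDint] at h1
  rw [intervalIntegral.integral_sub (hBc.intervalIntegrable _ _) (hi _ _), hfint]
  have h2 := abs_bernsteinMean_primitive_sub_le hf n.succ_pos (p := α) ⟨hα, hαβ.trans hβ⟩
  have h3 := abs_bernsteinMean_primitive_sub_le hf n.succ_pos (p := β) ⟨hα.trans hαβ, hβ⟩
  change |bernsteinMean (n + 1) F α - F α| ≤ _ at h2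
  change |bernsteinMean (n + 1) F β - F β| ≤ _ at h3
  have h4 : (1 : ℝ) / (n + 1) * |β - α| ≤ 1 / (n + 1) := by
    refine mul_le_of_le_one_right (by positivity) ?_
    rw [abs_of_nonneg (sub_nonneg.2 hαβ)]; linarith
  have h5 : (1 : ℝ) / (n + 1) ≤ 1 / n := by gcongr; linarith
  have h6 : (1 : ℝ) / (4 * (n + 1 : ℕ)) ≤ 1 / (2 * n) := by
    rw [hn1]; gcongr <;> linarith
  have h7 : (2 : ℝ) / n = 1 / n + (1 / (2 * n) + 1 / (2 * n)) := by field_simp; ring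
  rw [h7, abs_le]
  rw [abs_le] at h1 h2 h3
  constructor <;> linarith [h1.1, h1.2, h2.1, h2.2, h3.1, h3.2]

theorem le_bernsteinMean_abs_sub_half {n : ℕ} (hn : 0 < n) {p : ℝ} (hp : p ∈ Set.Icc (0 : ℝ) 1) :
    |p - 1 / 2| ≤ bernsteinMean n (fun x => |x - 1 / 2|) p := by
  have hn' : (n : ℝ) ≠ 0 := by positivity
  have hlin : binomialMean p n (fun k => (k : ℝ) / n - 1 / 2) = p - 1 / 2 := by
    have : (fun k : ℕ => (k : ℝ) / n - 1 / 2) =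
        fun k : ℕ => 1 / n * ((k : ℝ) - n * p) + (p - 1 / 2) := by
      ext k; field_simp; ring
    rw [this, binomialMean_add, binomialMean_const_mul, binomialMean_centered, binomialMean_const]
    ring
  have h := abs_binomialMean_sub_le hp (n := n) (g := fun k => (k : ℝ) / n - 1 / 2)
    (h := fun _ => 0) (b := fun k => |(k : ℝ) / n - 1 / 2|) fun k _ => by rw [sub_zero]
  rwa [hlin, binomialMean_const, sub_zero] at h

/-- A first absolute moment is bounded below by a second moment minus a fourth one, scaled at the
standard deviation `1/√n`; moving the centre from `p` to `1/2` costs little. -/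
theorem le_bernsteinMean_abs_sub_half_sub {n : ℕ} (hn : 0 < n) {p : ℝ}
    (hp : |p - 1 / 2| ≤ 1 / (128 * √n)) :
    1 / (64 * √n) ≤ bernsteinMean n (fun x => |x - 1 / 2|) p - |p - 1 / 2| := by
  have hn1 : (1 : ℝ) ≤ n := by exact_mod_cast hn
  have hn' : (0 : ℝ) < n := by exact_mod_cast hn
  have hs1 : 1 ≤ √(n : ℝ) := Real.one_le_sqrt.2 hn1
  have hs : 0 < √(n : ℝ) := by linarith
  have hss : √(n : ℝ) ^ 2 = n := Real.sq_sqrt hn'.le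
  set s := √(n : ℝ) with hsdef
  have hp4 : |p - 1 / 2| ≤ 1 / 4 := hp.trans (by
    apply one_div_le_one_div_of_le <;> linarith)
  rw [abs_le] at hp4
  have hpI : p ∈ Set.Icc (0 : ℝ) 1 := ⟨by linarith [hp4.1], by linarith [hp4.2]⟩
  have hv : 3 / 16 ≤ p * (1 - p) := by nlinarith [hp4.1, hp4.2]
  -- `t ≥ t² - t⁴` for `t = s |y| / 4`
  have hpt : ∀ y : ℝ, s / 4 * y ^ 2 + -(s ^ 3 / 64) * y ^ 4 ≤ |y| := fun y => by
    set t := s * |y| / 4 with ht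
    have ht0 : 0 ≤ t := by positivity
    have h1 : t ^ 2 - t ^ 4 ≤ t := by
      rcases le_or_gt t 1 with h | h
      · nlinarith [pow_nonneg ht0 4]
      · have : 1 ≤ t ^ 2 := one_le_pow₀ h.le
        nlinarith [sq_nonneg t]
    have h2 : s / 4 * y ^ 2 + -(s ^ 3 / 64) * y ^ 4 = 4 / s * (t ^ 2 - t ^ 4) := by
      have h4 : y ^ 4 = |y| ^ 4 := by rw [← Even.pow_abs (by decide : Even 4)]
      rw [ht, ← sq_abs y, h4]; field_simp; ring
    have h3 : |y| = 4 / s * t := by rw [ht]; field_simp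
    rw [h2, h3]
    exact mul_le_mul_of_nonneg_left h1 (by positivity)
  have h := binomialMean_mono hpI (n := n)
    (g := fun k => (s / 4 * ((k : ℝ) / n - p) ^ 2 + -(s ^ 3 / 64) * ((k : ℝ) / n - p) ^ 4) +
      -|p - 1 / 2|)
    (h := fun k => |(k : ℝ) / n - 1 / 2|) fun k _ => by
      have h1 := hpt ((k : ℝ) / n - p)
      have h2 := abs_sub_abs_le_abs_sub ((k : ℝ) / n - p) (1 / 2 - p)
      have h3 : (k : ℝ) / n - p - (1 / 2 - p) = k / n - 1 / 2 := by ring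
      rw [h3, abs_sub_comm (1 / 2) p] at h2
      linarith
  rw [binomialMean_add, binomialMean_add, binomialMean_const_mul, binomialMean_const_mul,
    binomialMean_const, bernsteinMean_sq hn] at h
  have h4 := bernsteinMean_pow_four_le hn hpI
  rw [← hss] at h4 h
  have h5 : 3 / (64 * s) ≤ s / 4 * (p * (1 - p) / s ^ 2) := by
    calc 3 / (64 * s) = s / 4 * (3 / 16 / s ^ 2) := by field_simp; norm_num
      _ ≤ _ := by gcongr
  have h6 : s ^ 3 / 64 * binomialMean p n (fun k => ((k : ℝ) / s ^ 2 - p) ^ 4) ≤ 1 / (64 * s) := by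
    calc _ ≤ s ^ 3 / 64 * (1 / (s ^ 2) ^ 2) := by gcongr
      _ = _ := by field_simp
  -- The balance is `3 - 1 - 1 = 1` in units of `1/(64 s)`: second moment, fourth moment, and twice
  -- `|p - 1/2|`; the remaining terms cancel.
  have h7 : (1 : ℝ) / (64 * s) = 3 / (64 * s) - 1 / (64 * s) - 2 * (1 / (128 * s)) +
      1 / (64 * s) - 1 / (64 * s) + 1 / (64 * s) - 1 / (64 * s) := by
    field_simp; norm_num
  rw [bernsteinMean, ← hss]
  linarith

/-! ### Mixtures of Bernoulli sequences -/

/-- The uniform distribution on `[0, 1]`. -/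
noncomputable def uniformIcc : Measure ℝ := volume.restrict (Set.Icc 0 1)

instance : IsProbabilityMeasure uniformIcc := ⟨by simp [uniformIcc]⟩

theorem uniformIcc_real_Iic {p : ℝ} (hp : p ∈ Set.Icc (0 : ℝ) 1) :
    uniformIcc.real (Set.Iic p) = p := by
  have : Set.Iic p ∩ Set.Icc 0 1 = Set.Icc 0 p := by
    ext x
    simp only [Set.mem_inter_iff, Set.mem_Iic, Set.mem_Icc]
    exact ⟨fun h => ⟨h.2.1, h.1⟩, fun h => ⟨h.2, h.1, h.2.trans hp.2⟩⟩
  rw [uniformIcc, measureReal_restrict_apply measurableSet_Iic, this, Real.volume_real_Icc_of_le hp.1,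
    sub_zero]

/-- An i.i.d. sequence of uniform variables. -/
noncomputable def uniformSeq : Measure (ℕ → ℝ) := Measure.infinitePi fun _ => uniformIcc

instance : IsProbabilityMeasure uniformSeq := by unfold uniformSeq; infer_instance

/-- The number of the first `n` terms of `U` which are at most `p`. -/
noncomputable def countLE (p : ℝ) (n : ℕ) (U : ℕ → ℝ) : ℕ :=
  ∑ k ∈ Finset.range n, if U k ≤ p then 1 else 0

theorem measurable_countLE (p : ℝ) (n : ℕ) : Measurable (countLE p n) :=
  Finset.measurable_fun_sum _ fun k _ =>
    Measurable.ite (measurableSet_le (measurable_pi_apply k) measurable_const) measurable_const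
      measurable_const

theorem countLE_le (p : ℝ) (n : ℕ) (U : ℕ → ℝ) : countLE p n U ≤ n := by
  calc countLE p n U ≤ ∑ k ∈ Finset.range n, 1 :=
        Finset.sum_le_sum fun k _ => by split_ifs <;> simp
    _ = n := by simp

theorem integrable_comp_countLE (p : ℝ) (n : ℕ) (h : ℕ → ℝ) :
    Integrable (fun U => h (countLE p n U)) uniformSeq := by
  refine Integrable.of_bound (measurable_from_top.comp (measurable_countLE p n)).aestronglyMeasurable
    (∑ k ∈ Finset.range (n + 1), ‖h k‖) (ae_of_all _ fun U => ?_)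
  exact Finset.single_le_sum (f := fun k => ‖h k‖) (fun k _ => norm_nonneg _)
    (Finset.mem_range.2 (Nat.lt_succ_of_le (countLE_le p n U)))

theorem indepFun_countLE (p : ℝ) (n : ℕ) :
    IndepFun (countLE p n) (fun U : ℕ → ℝ => if U n ≤ p then 1 else 0 : (ℕ → ℝ) → ℕ)
      uniformSeq := by
  have hm : Measurable fun u : ℝ => if u ≤ p then 1 else (0 : ℕ) :=
    Measurable.ite measurableSet_Iic measurable_const measurable_const
  have h : iIndepFun (fun (k : ℕ) (U : ℕ → ℝ) => if U k ≤ p then 1 else (0 : ℕ)) uniformSeq :=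
    iIndepFun_infinitePi (P := fun _ => uniformIcc)
      (X := fun _ u => if u ≤ p then 1 else (0 : ℕ)) fun _ => hm
  have := h.indepFun_finsetSum_of_notMem (fun k => hm.comp (measurable_pi_apply k))
    (s := Finset.range n) (i := n) (by simp)
  convert this using 1
  ext U
  simp [countLE]

/-- The last indicator is independent of the preceding count and has mean `p`, which reproduces the
recursion of `binomialMean`. -/
theorem integral_comp_countLE {p : ℝ} (hp : p ∈ Set.Icc (0 : ℝ) 1) (n : ℕ) (h : ℕ → ℝ) :
    ∫ U, h (countLE p n U) ∂uniformSeq = binomialMean p n h := by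
  induction n generalizing h with
  | zero => simp [countLE, binomialMean]
  | succ n ih =>
    set b : (ℕ → ℝ) → ℕ := fun U => if U n ≤ p then 1 else 0 with hb
    have hbm : Measurable b :=
      Measurable.ite (measurableSet_le (measurable_pi_apply n) measurable_const) measurable_const
        measurable_const
    have hsplit : ∀ U, h (countLE p (n + 1) U) =
        h (countLE p n U + 1) * b U + (h (countLE p n U) - h (countLE p n U) * b U) := fun U => by
      have : countLE p (n + 1) U = countLE p n U + b U := Finset.sum_range_succ _ _
      rw [this]
      by_cases hU : U n ≤ p <;> simp [hb, hU]
    have hbint : ∫ U, (b U : ℝ) ∂uniformSeq = p := by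
      have : (fun U => (b U : ℝ)) = fun U => (Set.Iic p).indicator (1 : ℝ → ℝ) (U n) := by
        ext U
        by_cases hU : U n ≤ p <;> simp [hb, hU]
      have hmap := integral_map (μ := uniformSeq) (φ := fun U : ℕ → ℝ => U n)
        (f := (Set.Iic p).indicator (1 : ℝ → ℝ)) (measurable_pi_apply n).aemeasurable
        (measurable_one.indicator measurableSet_Iic).aestronglyMeasurable
      rw [this, ← hmap, uniformSeq, Measure.infinitePi_map_eval (fun _ : ℕ => uniformIcc) n,
        integral_indicator_one measurableSet_Iic, uniformIcc_real_Iic hp]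
    have hprod : ∀ g : ℕ → ℝ, ∫ U, g (countLE p n U) * b U ∂uniformSeq =
        p * binomialMean p n g := fun g => by
      rw [(indepFun_countLE p n).integral_fun_comp_mul_comp (f := g) (g := fun j : ℕ => (j : ℝ))
        (measurable_countLE p n).aemeasurable hbm.aemeasurable
        measurable_from_top.aestronglyMeasurable measurable_from_top.aestronglyMeasurable, ih g,
        hbint, mul_comm]
    have hint : ∀ g : ℕ → ℝ, Integrable (fun U => g (countLE p n U) * b U) uniformSeq := fun g =>
      (integrable_comp_countLE p n g).mul_bdd (c := 1)
        (measurable_from_top.comp hbm).aestronglyMeasurable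
        (ae_of_all _ fun U => by by_cases hU : U n ≤ p <;> simp [hb, hU])
    simp only [hsplit]
    have hdiff : Integrable (fun U => h (countLE p n U) - h (countLE p n U) * b U) uniformSeq :=
      (integrable_comp_countLE p n h).sub (hint h)
    rw [integral_add (hint fun k => h (k + 1)) hdiff,
      integral_sub (integrable_comp_countLE p n h) (hint h), hprod fun k => h (k + 1), hprod h, ih h]
    simp only [binomialMean]
    ring

/-- The Bernoulli sequence with random parameter: given the first coordinate `p`, the variables
are independent with mean `p`. -/
noncomputable def mixedBernoulli (k : ℕ) (z : ℝ × (ℕ → ℝ)) : ℝ := if z.2 k ≤ z.1 then 1 else 0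

theorem measurable_mixedBernoulli (k : ℕ) : Measurable (mixedBernoulli k) :=
  Measurable.ite (measurableSet_le ((measurable_pi_apply k).comp measurable_snd) measurable_fst)
    measurable_const measurable_const

theorem isExchangeableZeroOne_mixedBernoulli (ν : Measure ℝ) [IsProbabilityMeasure ν] :
    IsExchangeableZeroOne mixedBernoulli (ν.prod uniformSeq) where
  measurable := measurable_mixedBernoulli
  zero_or_one k z := by unfold mixedBernoulli; split_ifs <;> simp
  exchangeable n σ := by
    -- Extending `σ` by the identity gives an injective reindexing, which preserves the i.i.d. law.
    set e : ℕ → ℕ := fun k => if h : k < n then (σ ⟨k, h⟩ : ℕ) else k with he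
    have hinj : Function.Injective e := fun i j hij => by
      simp only [he] at hij
      split_ifs at hij with hi hj hj
      · have := σ.injective (Fin.ext hij)
        exact congrArg Fin.val this
      · exact absurd (hij ▸ (σ ⟨i, hi⟩).isLt) hj
      · exact absurd (hij ▸ (σ ⟨j, hj⟩).isLt) hi
      · exact hij
    have hmapU : uniformSeq.map (fun U k => U (e k)) = uniformSeq :=
      Measure.map_infinitePi_infinitePi_of_inj (P := fun _ => uniformIcc) hinj
    have hUm : Measurable fun (U : ℕ → ℝ) k => U (e k) :=
      measurable_pi_lambda _ fun k => measurable_pi_apply _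
    have hmap : (ν.prod uniformSeq).map (Prod.map id fun U k => U (e k)) = ν.prod uniformSeq := by
      rw [← Measure.map_prod_map _ _ measurable_id hUm, hmapU, Measure.map_id]
    conv_rhs => rw [← hmap]
    rw [Measure.map_map (measurable_pi_lambda _ fun i => measurable_mixedBernoulli _)
      (measurable_id.prodMap hUm)]
    congr 1
    ext z i
    simp [mixedBernoulli, he]

theorem empiricalMean_mixedBernoulli (n : ℕ) (z : ℝ × (ℕ → ℝ)) :
    empiricalMean mixedBernoulli n z = countLE z.1 n z.2 / n := by
  simp [empiricalMean, mixedBernoulli, countLE]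

/-- Fubini, conditioning on the parameter. The test function may depend on `p`, as needed for the
deviation `|y - p|`. -/
theorem integral_comp_empiricalMean_mixedBernoulli (ν : Measure ℝ) [IsProbabilityMeasure ν]
    (hν : ∀ᵐ p ∂ν, p ∈ Set.Icc (0 : ℝ) 1) (n : ℕ) {φ : ℝ → ℝ → ℝ}
    (hφ : Integrable (fun z => φ z.1 (empiricalMean mixedBernoulli n z)) (ν.prod uniformSeq)) :
    ∫ z, φ z.1 (empiricalMean mixedBernoulli n z) ∂(ν.prod uniformSeq) =
      ∫ p, bernsteinMean n (φ p) p ∂ν := by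
  rw [integral_prod _ hφ]
  refine integral_congr_ae ?_
  filter_upwards [hν] with p hp
  simp only [empiricalMean_mixedBernoulli]
  exact integral_comp_countLE hp n fun k => φ p (k / n)

theorem integrable_of_continuous_of_ae_mem_Icc {Ω : Type*} [MeasurableSpace Ω] {P : Measure Ω}
    [IsFiniteMeasure P] {X Y : Ω → ℝ} (hX : Measurable X) (hY : Measurable Y)
    (hX1 : ∀ᵐ ω ∂P, X ω ∈ Set.Icc (0 : ℝ) 1) (hY1 : ∀ᵐ ω ∂P, Y ω ∈ Set.Icc (0 : ℝ) 1)
    {φ : ℝ × ℝ → ℝ} (hφ : Continuous φ) : Integrable (fun ω => φ (X ω, Y ω)) P := by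
  obtain ⟨C, hC⟩ := (isCompact_Icc.prod isCompact_Icc : IsCompact
    (Set.Icc (0 : ℝ) 1 ×ˢ Set.Icc (0 : ℝ) 1)).exists_bound_of_continuousOn hφ.continuousOn
  refine Integrable.of_bound (hφ.measurable.comp (hX.prodMk hY)).aestronglyMeasurable C ?_
  filter_upwards [hX1, hY1] with ω h1 h2 using hC _ ⟨h1, h2⟩

theorem ae_fst_mem_Icc {ν : Measure ℝ} [IsProbabilityMeasure ν]
    (hν : ∀ᵐ p ∂ν, p ∈ Set.Icc (0 : ℝ) 1) :
    ∀ᵐ z ∂(ν.prod uniformSeq), z.1 ∈ Set.Icc (0 : ℝ) 1 :=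
  Measure.quasiMeasurePreserving_fst.ae hν

/-- Conditionally on `p` the mean deviation is at most `1/√n`, so convergence holds already in `L¹`.
-/
theorem tendstoInDistribution_empiricalMean_mixedBernoulli (ν : Measure ℝ)
    [IsProbabilityMeasure ν] (hν : ∀ᵐ p ∂ν, p ∈ Set.Icc (0 : ℝ) 1) :
    TendstoInDistribution (empiricalMean mixedBernoulli) atTop Prod.fst
      (fun _ => ν.prod uniformSeq) (ν.prod uniformSeq) := by
  have hX := isExchangeableZeroOne_mixedBernoulli ν
  have hm := hX.measurable_empiricalMean
  refine TendstoInMeasure.tendstoInDistribution ?_ fun n => (hm n).aemeasurable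
  refine tendstoInMeasure_of_tendsto_eLpNorm one_ne_zero (fun n => (hm n).aestronglyMeasurable)
    measurable_fst.aestronglyMeasurable ?_
  have hlim : Tendsto (fun n : ℕ => ENNReal.ofReal (1 / √n)) atTop (𝓝 0) := by
    rw [← ENNReal.ofReal_zero]
    refine ENNReal.tendsto_ofReal ?_
    simp only [one_div]
    exact tendsto_inv_atTop_zero.comp (Real.tendsto_sqrt_atTop.comp tendsto_natCast_atTop_atTop)
  refine tendsto_of_tendsto_of_tendsto_of_le_of_le' tendsto_const_nhds hlim
    (Eventually.of_forall fun n => zero_le) ?_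
  filter_upwards [eventually_gt_atTop 0] with n hn
  have hint : Integrable (fun z => |empiricalMean mixedBernoulli n z - z.1|) (ν.prod uniformSeq) :=
    integrable_of_continuous_of_ae_mem_Icc (hm n) measurable_fst
      (ae_of_all _ (hX.empiricalMean_mem_Icc n)) (ae_fst_mem_Icc hν)
      (φ := fun w => |w.1 - w.2|) (by fun_prop)
  rw [eLpNorm_one_eq_lintegral_enorm]
  simp only [Pi.sub_apply, Real.enorm_eq_ofReal_abs]
  rw [← ofReal_integral_eq_lintegral_ofReal hint (ae_of_all _ fun z => abs_nonneg _)]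
  apply ENNReal.ofReal_le_ofReal
  rw [integral_comp_empiricalMean_mixedBernoulli ν hν n (φ := fun p y => |y - p|) hint]
  have hle : ∀ᵐ p ∂ν, ‖bernsteinMean n (fun y => |y - p|) p‖ ≤ 1 / √n := by
    filter_upwards [hν] with p hp
    have hl : LipschitzWith 1 fun y => |y - p| := by
      refine LipschitzWith.of_dist_le_mul fun x y => ?_
      rw [Real.dist_eq, Real.dist_eq, NNReal.coe_one, one_mul]
      simpa using abs_abs_sub_abs_le_abs_sub (x - p) (y - p)
    simpa using abs_bernsteinMean_sub_le hl hn hp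
  refine (le_abs_self _).trans ((norm_integral_le_of_norm_le_const hle).trans ?_)
  simp

theorem integral_map_empiricalMean_sub_integral (ν : Measure ℝ) [IsProbabilityMeasure ν]
    (hν : ∀ᵐ p ∂ν, p ∈ Set.Icc (0 : ℝ) 1) (n : ℕ) {f : ℝ → ℝ} (hf : Continuous f) :
    ∫ x, f x ∂((ν.prod uniformSeq).map (empiricalMean mixedBernoulli n)) - ∫ x, f x ∂ν =
      ∫ p, (bernsteinMean n f p - f p) ∂ν := by
  have hX := isExchangeableZeroOne_mixedBernoulli ν
  have hm := hX.measurable_empiricalMean n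
  have hint : Integrable (fun z => f (empiricalMean mixedBernoulli n z)) (ν.prod uniformSeq) :=
    integrable_of_continuous_of_ae_mem_Icc hm measurable_fst
      (ae_of_all _ (hX.empiricalMean_mem_Icc n)) (ae_fst_mem_Icc hν)
      (φ := fun w => f w.1) (by fun_prop)
  have hB : Continuous (bernsteinMean n f) := continuous_binomialMean n _
  rw [integral_map hm.aemeasurable hf.aestronglyMeasurable,
    integral_comp_empiricalMean_mixedBernoulli ν hν n (φ := fun _ y => f y) hint,
    integral_sub]
  · exact integrable_of_continuous_of_ae_mem_Icc measurable_id measurable_id hν hν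
      (φ := fun w => bernsteinMean n f w.1) (by fun_prop)
  · exact integrable_of_continuous_of_ae_mem_Icc measurable_id measurable_id hν hν
      (φ := fun w => f w.1) (by fun_prop)

/-- Duality needs all Lipschitz functions from above, but the single function `|x - 1/2|` from
below. -/
theorem hasWassersteinRate_mixedBernoulli (ν : Measure ℝ) [IsProbabilityMeasure ν]
    (hν : ∀ᵐ p ∂ν, p ∈ Set.Icc (0 : ℝ) 1) {δ C c : ℝ} (hc : 0 < c)
    (hupper : ∀ n : ℕ, 0 < n → ∀ f : ℝ → ℝ, LipschitzWith 1 f →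
      ∫ p, (bernsteinMean n f p - f p) ∂ν ≤ C * (n : ℝ) ^ (-δ))
    (hlower : ∀ n : ℕ, 0 < n → c * (n : ℝ) ^ (-δ) ≤
      ∫ p, (bernsteinMean n (fun x => |x - 1 / 2|) p - |p - 1 / 2|) ∂ν) :
    HasWassersteinRate mixedBernoulli (ν.prod uniformSeq) Prod.fst (ν.prod uniformSeq) δ := by
  have hX := isExchangeableZeroOne_mixedBernoulli ν
  have hm := hX.measurable_empiricalMean
  have hfst : (ν.prod uniformSeq).map Prod.fst = ν := by
    rw [Measure.map_fst_prod]; simp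
  set D : ℕ → ℝ≥0∞ := fun n =>
    wassersteinDist ((ν.prod uniformSeq).map (empiricalMean mixedBernoulli n)) ν with hD
  have hprob : ∀ n, IsProbabilityMeasure
      ((ν.prod uniformSeq).map (empiricalMean mixedBernoulli n)) := fun n =>
    Measure.isProbabilityMeasure_map (hm n).aemeasurable
  have hsupp : ∀ n, ∀ᵐ x ∂((ν.prod uniformSeq).map (empiricalMean mixedBernoulli n)),
      x ∈ Set.Icc (0 : ℝ) 1 := fun n =>
    (ae_map_iff (hm n).aemeasurable measurableSet_Icc).2
      (ae_of_all _ (hX.empiricalMean_mem_Icc n))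
  have hcont : Continuous fun x : ℝ => |x - 1 / 2| := by fun_prop
  have hub : ∀ n : ℕ, 0 < n → D n ≤ ENNReal.ofReal (C * (n : ℝ) ^ (-δ)) := fun n hn =>
    wassersteinDist_le_of_forall_lipschitz _ ν (hsupp n) hν fun f hf => by
      rw [integral_map_empiricalMean_sub_integral ν hν n hf.continuous]
      exact hupper n hn f hf
  have hfin : ∀ n : ℕ, 0 < n → D n ≠ ∞ := fun n hn =>
    ((hub n hn).trans_lt ENNReal.ofReal_lt_top).ne
  have hlb : ∀ n : ℕ, 0 < n → c * (n : ℝ) ^ (-δ) ≤ (D n).toReal := fun n hn => by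
    refine (hlower n hn).trans ?_
    rw [← integral_map_empiricalMean_sub_integral ν hν n hcont, sub_le_iff_le_add']
    have h := lintegral_lipschitz_le_add_wassersteinDist
      ((ν.prod uniformSeq).map (empiricalMean mixedBernoulli n)) ν hcont.measurable one_pos
      fun x y => by
        rw [one_mul]
        simpa using abs_sub_abs_le_abs_sub (x - 1 / 2) (y - 1 / 2)
    have hi1 : Integrable (fun x : ℝ => |x - 1 / 2|)
        ((ν.prod uniformSeq).map (empiricalMean mixedBernoulli n)) :=
      integrable_of_continuous_of_ae_mem_Icc measurable_id measurable_id (hsupp n) (hsupp n)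
        (φ := fun w => |w.1 - 1 / 2|) (by fun_prop)
    have hi2 : Integrable (fun x : ℝ => |x - 1 / 2|) ν :=
      integrable_of_continuous_of_ae_mem_Icc measurable_id measurable_id hν hν
        (φ := fun w => |w.1 - 1 / 2|) (by fun_prop)
    rw [← ofReal_integral_eq_lintegral_ofReal hi1 (ae_of_all _ fun _ => abs_nonneg _),
      ← ofReal_integral_eq_lintegral_ofReal hi2 (ae_of_all _ fun _ => abs_nonneg _),
      ENNReal.ofReal_one, one_mul] at h
    have h0 : 0 ≤ ∫ x : ℝ, |x - 1 / 2| ∂ν := integral_nonneg fun _ => abs_nonneg _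
    have := ENNReal.toReal_mono (ENNReal.add_ne_top.2 ⟨ENNReal.ofReal_ne_top, hfin n hn⟩) h
    rwa [ENNReal.toReal_ofReal (integral_nonneg fun _ => abs_nonneg _),
      ENNReal.toReal_add ENNReal.ofReal_ne_top (hfin n hn), ENNReal.toReal_ofReal h0] at this
  unfold HasWassersteinRate wassersteinDistRV
  rw [hfst]
  constructor
  · refine IsBigO.of_bound C ?_
    filter_upwards [eventually_gt_atTop 0] with n hn
    have hpow : 0 < (n : ℝ) ^ (-δ) := Real.rpow_pos_of_pos (by exact_mod_cast hn) _
    -- The sign of `C` is not assumed: a negative bound would force `D n = 0`, against the lower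
    -- bound.
    have hC : 0 ≤ C * (n : ℝ) ^ (-δ) := by
      by_contra hneg
      have h1 := hub n hn
      rw [ENNReal.ofReal_of_nonpos (not_le.1 hneg).le] at h1
      have h2 := hlb n hn
      rw [le_antisymm h1 zero_le, ENNReal.toReal_zero] at h2
      exact absurd h2 (not_le.2 (mul_pos hc hpow))
    rw [Real.norm_of_nonneg ENNReal.toReal_nonneg, Real.norm_of_nonneg hpow.le]
    exact ENNReal.toReal_le_of_le_ofReal hC (hub n hn)
  · refine IsBigO.of_bound (1 / c) ?_
    filter_upwards [eventually_gt_atTop 0] with n hn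
    rw [Real.norm_of_nonneg ENNReal.toReal_nonneg,
      Real.norm_of_nonneg (Real.rpow_nonneg n.cast_nonneg _), one_div, ← div_eq_inv_mul,
      le_div_iff₀ hc, mul_comm]
    exact hlb n hn

/-! ### Priors concentrated around `1 / 2` -/

/-- The law of `1 / 2 + r(U) (2 V - 1)` for independent uniform variables `U` and `V`: a mixture of
uniform distributions on intervals centered at `1 / 2`. -/
noncomputable def centeredMixture (r : ℝ → ℝ) : Measure ℝ :=
  (uniformIcc.prod uniformIcc).map fun z => 1 / 2 + r z.1 * (2 * z.2 - 1)

theorem one_div_sqrt_eq_rpow {n : ℕ} : 1 / √(n : ℝ) = (n : ℝ) ^ (-(1 / 2) : ℝ) := by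
  rw [Real.sqrt_eq_rpow, one_div, ← Real.rpow_neg n.cast_nonneg]

section CenteredMixture

variable {r : ℝ → ℝ}

theorem measurable_centered (hr : Measurable r) :
    Measurable fun z : ℝ × ℝ => 1 / 2 + r z.1 * (2 * z.2 - 1) := by fun_prop

theorem isProbabilityMeasure_centeredMixture (hr : Measurable r) :
    IsProbabilityMeasure (centeredMixture r) :=
  Measure.isProbabilityMeasure_map (measurable_centered hr).aemeasurable

theorem ae_uniformIcc_mem : ∀ᵐ u ∂uniformIcc, u ∈ Set.Icc (0 : ℝ) 1 :=
  ae_restrict_mem measurableSet_Icc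

theorem ae_uniformIcc_prod_mem : ∀ᵐ z ∂(uniformIcc.prod uniformIcc),
    z.1 ∈ Set.Icc (0 : ℝ) 1 ∧ z.2 ∈ Set.Icc (0 : ℝ) 1 :=
  (Measure.quasiMeasurePreserving_fst.ae ae_uniformIcc_mem).and
    (Measure.quasiMeasurePreserving_snd.ae ae_uniformIcc_mem)

theorem centered_mem_Icc {r v : ℝ} (hr : r ∈ Set.Icc (0 : ℝ) (1 / 2)) (hv : v ∈ Set.Icc (0 : ℝ) 1) :
    1 / 2 + r * (2 * v - 1) ∈ Set.Icc (0 : ℝ) 1 := by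
  obtain ⟨h1, h2⟩ := hr
  obtain ⟨h3, h4⟩ := hv
  constructor <;> nlinarith

theorem ae_centered_mem (hr1 : ∀ u ∈ Set.Icc (0 : ℝ) 1, r u ∈ Set.Icc (0 : ℝ) (1 / 2)) :
    ∀ᵐ z ∂(uniformIcc.prod uniformIcc), 1 / 2 + r z.1 * (2 * z.2 - 1) ∈ Set.Icc (0 : ℝ) 1 := by
  filter_upwards [ae_uniformIcc_prod_mem] with z hz using centered_mem_Icc (hr1 _ hz.1) hz.2

theorem ae_centeredMixture_mem (hr : Measurable r)
    (hr1 : ∀ u ∈ Set.Icc (0 : ℝ) 1, r u ∈ Set.Icc (0 : ℝ) (1 / 2)) :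
    ∀ᵐ p ∂(centeredMixture r), p ∈ Set.Icc (0 : ℝ) 1 :=
  (ae_map_iff (measurable_centered hr).aemeasurable measurableSet_Icc).2 (ae_centered_mem hr1)

theorem integrable_centered (hr : Measurable r)
    (hr1 : ∀ u ∈ Set.Icc (0 : ℝ) 1, r u ∈ Set.Icc (0 : ℝ) (1 / 2)) {g : ℝ → ℝ}
    (hg : Continuous g) :
    Integrable (fun z : ℝ × ℝ => g (1 / 2 + r z.1 * (2 * z.2 - 1)))
      (uniformIcc.prod uniformIcc) :=
  integrable_of_continuous_of_ae_mem_Icc (measurable_centered hr) (measurable_centered hr)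
    (ae_centered_mem hr1) (ae_centered_mem hr1) (φ := fun w => g w.1) (by fun_prop)

/-- Rescaling to an interval of length `2ρ` divides the averaged error `2/n` by `2ρ`. -/
theorem integral_uniformIcc_bernsteinMean_sub_le {f : ℝ → ℝ} (hf : LipschitzWith 1 f) {n : ℕ}
    (hn : 0 < n) {ρ : ℝ} (hρ : ρ ∈ Set.Icc (0 : ℝ) (1 / 2)) (hρ0 : 0 < ρ) :
    ∫ v, (bernsteinMean n f (1 / 2 + ρ * (2 * v - 1)) - f (1 / 2 + ρ * (2 * v - 1))) ∂uniformIcc ≤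
      1 / (ρ * n) := by
  have hn' : (0 : ℝ) < n := by exact_mod_cast hn
  rw [uniformIcc, integral_Icc_eq_integral_Ioc, ← intervalIntegral.integral_of_le zero_le_one]
  have h := intervalIntegral.integral_comp_mul_add (a := 0) (b := 1)
    (fun p => bernsteinMean n f p - f p) (c := 2 * ρ) (by positivity) (1 / 2 - ρ)
  have hEq : ∀ v : ℝ, 1 / 2 + ρ * (2 * v - 1) = 2 * ρ * v + (1 / 2 - ρ) := fun v => by ring
  simp only [hEq]
  rw [h, smul_eq_mul]
  have hb := abs_integral_bernsteinMean_sub_le hf hn (α := 2 * ρ * 0 + (1 / 2 - ρ))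
    (β := 2 * ρ * 1 + (1 / 2 - ρ)) (by linarith [hρ.2]) (by linarith) (by linarith [hρ.2])
  calc (2 * ρ)⁻¹ * _ ≤ (2 * ρ)⁻¹ * (2 / n) :=
        mul_le_mul_of_nonneg_left (le_of_abs_le hb) (by positivity)
    _ = 1 / (ρ * n) := by field_simp

/-- At each radius the majorant `G` may use either the pointwise bound or the averaged one; `u = 0`,
where the radius may vanish, is a null set. -/
theorem integral_centeredMixture_le (hr : Measurable r)
    (hr1 : ∀ u ∈ Set.Icc (0 : ℝ) 1, r u ∈ Set.Icc (0 : ℝ) (1 / 2)) {n : ℕ} (hn : 0 < n)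
    {G : ℝ → ℝ} (hG : Integrable G uniformIcc)
    (h : ∀ u ∈ Set.Ioc (0 : ℝ) 1, 1 / √n ≤ G u ∨ (0 < r u ∧ 1 / (r u * n) ≤ G u))
    {f : ℝ → ℝ} (hf : LipschitzWith 1 f) :
    ∫ p, (bernsteinMean n f p - f p) ∂(centeredMixture r) ≤ ∫ u, G u ∂uniformIcc := by
  have hfc := hf.continuous
  have hB : Continuous (bernsteinMean n f) := continuous_binomialMean n _
  have hg : Continuous fun p => bernsteinMean n f p - f p := hB.sub hfc
  have hint := integrable_centered hr hr1 hg
  rw [centeredMixture, integral_map (measurable_centered hr).aemeasurable hg.aestronglyMeasurable,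
    integral_prod _ hint]
  refine integral_mono_ae hint.integral_prod_left hG ?_
  have hpos : ∀ᵐ u ∂uniformIcc, u ∈ Set.Ioc (0 : ℝ) 1 := by
    rw [uniformIcc, ← Measure.restrict_congr_set Ioc_ae_eq_Icc]
    exact ae_restrict_mem measurableSet_Ioc
  filter_upwards [hpos] with u hu
  have hru := hr1 u ⟨hu.1.le, hu.2⟩
  rcases h u hu with h1 | ⟨h1, h2⟩
  · refine le_trans ?_ h1
    have hle : ∀ᵐ v ∂uniformIcc, ‖bernsteinMean n f (1 / 2 + r u * (2 * v - 1)) -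
        f (1 / 2 + r u * (2 * v - 1))‖ ≤ 1 / √n := by
      filter_upwards [ae_uniformIcc_mem] with v hv
      exact abs_bernsteinMean_sub_le hf hn (centered_mem_Icc hru hv)
    refine (le_abs_self _).trans ((norm_integral_le_of_norm_le_const hle).trans ?_)
    simp
  · exact (integral_uniformIcc_bernsteinMean_sub_le hf hn hru h1).trans h2

/-- The integrand is nonnegative by Jensen, so everything outside `s ×ˢ t` can be dropped. -/
theorem le_integral_centeredMixture (hr : Measurable r)
    (hr1 : ∀ u ∈ Set.Icc (0 : ℝ) 1, r u ∈ Set.Icc (0 : ℝ) (1 / 2)) {n : ℕ} (hn : 0 < n)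
    {s t : Set ℝ} (hs : MeasurableSet s) (ht : MeasurableSet t)
    (h : ∀ u ∈ s, ∀ v ∈ t, |r u * (2 * v - 1)| ≤ 1 / (128 * √n)) :
    uniformIcc.real s * uniformIcc.real t * (1 / (64 * √n)) ≤
      ∫ p, (bernsteinMean n (fun x => |x - 1 / 2|) p - |p - 1 / 2|) ∂(centeredMixture r) := by
  have hB : Continuous (bernsteinMean n fun x => |x - 1 / 2|) := continuous_binomialMean n _
  have hg : Continuous fun p => bernsteinMean n (fun x => |x - 1 / 2|) p - |p - 1 / 2| :=
    hB.sub (by fun_prop)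
  have hint := integrable_centered hr hr1 hg
  rw [centeredMixture, integral_map (measurable_centered hr).aemeasurable hg.aestronglyMeasurable]
  rw [← measureReal_prod_prod, ← smul_eq_mul, ← integral_indicator_const _ (hs.prod ht)]
  refine integral_mono_ae ((integrable_const _).indicator (hs.prod ht)) hint ?_
  filter_upwards [ae_centered_mem hr1] with z hz
  by_cases hst : z ∈ s ×ˢ t
  · rw [Set.indicator_of_mem hst]
    refine le_bernsteinMean_abs_sub_half_sub hn ?_
    rw [add_sub_cancel_left]
    exact h _ hst.1 _ hst.2
  · rw [Set.indicator_of_notMem hst]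
    exact sub_nonneg.2 (le_bernsteinMean_abs_sub_half hn hz)

/-- A mixing profile `r` realizes the rate `δ` if it meets the two quantitative conditions used
for the upper and the lower bound. -/
theorem hasWassersteinRate_centeredMixture (hr : Measurable r)
    (hr1 : ∀ u ∈ Set.Icc (0 : ℝ) 1, r u ∈ Set.Icc (0 : ℝ) (1 / 2)) {δ C c : ℝ} (hc : 0 < c)
    (hupper : ∀ n : ℕ, 0 < n → ∃ G : ℝ → ℝ, Integrable G uniformIcc ∧
      (∀ u ∈ Set.Ioc (0 : ℝ) 1, 1 / √n ≤ G u ∨ (0 < r u ∧ 1 / (r u * n) ≤ G u)) ∧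
      ∫ u, G u ∂uniformIcc ≤ C * (n : ℝ) ^ (-δ))
    (hlower : ∀ n : ℕ, 0 < n → ∃ s t : Set ℝ, MeasurableSet s ∧ MeasurableSet t ∧
      (∀ u ∈ s, ∀ v ∈ t, |r u * (2 * v - 1)| ≤ 1 / (128 * √n)) ∧
      c * (n : ℝ) ^ (1 / 2 - δ) ≤ uniformIcc.real s * uniformIcc.real t) :
    HasWassersteinRate mixedBernoulli ((centeredMixture r).prod uniformSeq) Prod.fst
      ((centeredMixture r).prod uniformSeq) δ := by
  have := isProbabilityMeasure_centeredMixture hr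
  refine hasWassersteinRate_mixedBernoulli _ (ae_centeredMixture_mem hr hr1) (C := C)
    (c := c / 64) (by positivity) (fun n hn f hf => ?_) fun n hn => ?_
  · obtain ⟨G, hG, h1, h2⟩ := hupper n hn
    exact (integral_centeredMixture_le hr hr1 hn hG h1 hf).trans h2
  · obtain ⟨s, t, hs, ht, h1, h2⟩ := hlower n hn
    refine le_trans ?_ (le_integral_centeredMixture hr hr1 hn hs ht h1)
    have hn' : (0 : ℝ) < n := by exact_mod_cast hn
    have hpow : (n : ℝ) ^ (-δ) = (n : ℝ) ^ (1 / 2 - δ) * (1 / √n) := by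
      rw [one_div_sqrt_eq_rpow, ← Real.rpow_add hn']
      congr 1; ring
    calc c / 64 * (n : ℝ) ^ (-δ) = c * (n : ℝ) ^ (1 / 2 - δ) * (1 / (64 * √n)) := by
          rw [hpow]; field_simp
      _ ≤ _ := by gcongr

end CenteredMixture

/-! ### Explicit radius profiles for each rate -/

theorem uniformIcc_real_Icc {a b : ℝ} (ha : 0 ≤ a) (hab : a ≤ b) (hb : b ≤ 1) :
    uniformIcc.real (Set.Icc a b) = b - a := by
  rw [uniformIcc, measureReal_restrict_apply measurableSet_Icc,
    Set.inter_eq_left.2 (Set.Icc_subset_Icc ha hb), Real.volume_real_Icc_of_le hab]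

/-- The prior is a point mass at `1/2`: an i.i.d. fair coin. -/
theorem hasWassersteinRate_half :
    HasWassersteinRate mixedBernoulli ((centeredMixture fun _ => 0).prod uniformSeq) Prod.fst
      ((centeredMixture fun _ => 0).prod uniformSeq) (1 / 2) := by
  refine hasWassersteinRate_centeredMixture measurable_const (fun u _ => by norm_num) (C := 1)
    (c := 1) one_pos (fun n hn => ⟨fun _ => 1 / √n, integrable_const _,
      fun u _ => Or.inl le_rfl, ?_⟩)
    fun n hn => ⟨Set.univ, Set.univ, .univ, .univ, fun u _ v _ => ?_, by simp⟩
  · rw [one_mul, ← one_div_sqrt_eq_rpow]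
    simp
  · rw [zero_mul, abs_zero]; positivity

/-- The prior is uniform on `[0,1]`, and the window around `1/2` has length `1/(64√n)`. -/
theorem hasWassersteinRate_one :
    HasWassersteinRate mixedBernoulli ((centeredMixture fun _ => 1 / 2).prod uniformSeq) Prod.fst
      ((centeredMixture fun _ => 1 / 2).prod uniformSeq) 1 := by
  refine hasWassersteinRate_centeredMixture measurable_const (fun u _ => by norm_num) (C := 2)
    (c := 1 / 64) (by norm_num) (fun n hn => ⟨fun _ => 2 / n, integrable_const _,
      fun u _ => Or.inr ⟨by norm_num, le_of_eq (by field_simp)⟩, ?_⟩)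
    fun n hn => ⟨Set.univ, Set.Icc (1 / 2 - 1 / (128 * √n)) (1 / 2 + 1 / (128 * √n)), .univ,
      measurableSet_Icc, fun u _ v hv => ?_, ?_⟩
  · rw [Real.rpow_neg_one]
    simp [div_eq_mul_inv]
  · rw [abs_le]
    constructor <;> linarith [hv.1, hv.2]
  · have hs : 1 ≤ √(n : ℝ) := Real.one_le_sqrt.2 (by exact_mod_cast hn)
    have h2 : 1 / (128 * √(n : ℝ)) ≤ 1 / 2 := by
      apply one_div_le_one_div_of_le <;> linarith
    have h3 : 0 < 1 / (128 * √(n : ℝ)) := by positivity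
    rw [uniformIcc_real_Icc (by linarith) (by linarith) (by linarith), probReal_univ, one_mul,
      show (1 / 2 - 1 : ℝ) = -(1 / 2) by norm_num, ← one_div_sqrt_eq_rpow]
    apply le_of_eq
    field_simp
    norm_num

theorem hasWassersteinRate_of_mem_Ioo {a : ℝ} (ha : a ∈ Set.Ioo (0 : ℝ) 1) :
    HasWassersteinRate mixedBernoulli
      ((centeredMixture fun u => u ^ (1 / a) / 2).prod uniformSeq) Prod.fst
      ((centeredMixture fun u => u ^ (1 / a) / 2).prod uniformSeq) ((1 + a) / 2) := by
  obtain ⟨ha0, ha1⟩ := ha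
  have hr : Measurable fun u : ℝ => u ^ (1 / a) / 2 := by fun_prop
  set b := 1 / a with hb
  have hb0 : 0 < b := by positivity
  have hb1 : 1 < b := by rw [hb, lt_div_iff₀ ha0]; linarith
  refine hasWassersteinRate_centeredMixture hr (fun u hu => ?_) (C := 1 + 2 / (b - 1))
    (c := (1 / 128) ^ a) (by positivity) (fun n hn => ?_) fun n hn => ?_
  · have h1 := Real.rpow_nonneg hu.1 b
    have h2 := Real.rpow_le_one hu.1 hu.2 hb0.le
    constructor <;> linarith
  · have hn1 : (1 : ℝ) ≤ n := by exact_mod_cast hn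
    have hn' : (0 : ℝ) < n := by linarith
    -- At this threshold the radius is `1/(2√n)`, where the pointwise and averaged bounds are of the
    -- same order; `b > 1` makes the integral of `u ^ (-b)` over `[τ, 1]` concentrate near `τ`.
    set τ : ℝ := (n : ℝ) ^ (-(a / 2)) with hτ
    have hτ0 : 0 < τ := Real.rpow_pos_of_pos hn' _
    have hτ1 : τ ≤ 1 := Real.rpow_le_one_of_one_le_of_nonpos hn1 (by linarith)
    set G₁ : ℝ → ℝ := (Set.Icc 0 τ).indicator fun _ => 1 / √n with hG₁
    set G₂ : ℝ → ℝ := (Set.Icc τ 1).indicator fun u => 2 / n * u ^ (-b) with hG₂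
    have hci : IntegrableOn (fun u : ℝ => 2 / n * u ^ (-b)) (Set.Icc τ 1) := by
      refine ContinuousOn.integrableOn_Icc (continuousOn_const.mul ?_)
      exact continuousOn_id.rpow_const fun x hx => Or.inl (hτ0.trans_le hx.1).ne'
    have hi1 : Integrable G₁ uniformIcc := (integrable_const _).indicator measurableSet_Icc
    have hi2 : Integrable G₂ uniformIcc :=
      ((integrable_indicator_iff measurableSet_Icc).2 hci).restrict
    have hτb : τ ^ (-b + 1) = (n : ℝ) ^ ((1 - a) / 2) := by
      rw [hτ, ← Real.rpow_mul hn'.le]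
      congr 1
      rw [hb]; field_simp; ring
    refine ⟨fun u => G₁ u + G₂ u, hi1.add hi2, fun u hu => ?_, ?_⟩
    · have hG1 : 0 ≤ G₁ u := Set.indicator_nonneg (fun _ _ => by positivity) _
      have hG2 : 0 ≤ G₂ u := Set.indicator_nonneg (fun x hx =>
        mul_nonneg (by positivity) (Real.rpow_nonneg (hτ0.le.trans hx.1) _)) _
      rcases le_total u τ with h | h
      · left
        have : G₁ u = 1 / √n := Set.indicator_of_mem (s := Set.Icc 0 τ) ⟨hu.1.le, h⟩ _
        linarith
      · right
        have hpow : 0 < u ^ b := Real.rpow_pos_of_pos hu.1 _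
        have : G₂ u = 2 / n * u ^ (-b) := Set.indicator_of_mem (s := Set.Icc τ 1) ⟨h, hu.2⟩ _
        refine ⟨by positivity, ?_⟩
        have h2 : 1 / (u ^ b / 2 * n) = 2 / n * u ^ (-b) := by
          rw [Real.rpow_neg hu.1.le]; field_simp
        linarith
    · have h1 : ∫ u, G₁ u ∂uniformIcc = (n : ℝ) ^ (-((1 + a) / 2)) := by
        rw [hG₁, integral_indicator_const _ measurableSet_Icc,
          uniformIcc_real_Icc le_rfl hτ0.le hτ1, sub_zero, smul_eq_mul, one_div_sqrt_eq_rpow, hτ,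
          ← Real.rpow_add hn']
        congr 1; ring
      have h2 : ∫ u, G₂ u ∂uniformIcc ≤ 2 / (b - 1) * (n : ℝ) ^ (-((1 + a) / 2)) := by
        have hnot : (0 : ℝ) ∉ Set.uIcc τ 1 := by
          rw [Set.uIcc_of_le hτ1]
          exact fun h => absurd h.1 (not_le.2 hτ0)
        rw [hG₂, uniformIcc, setIntegral_indicator measurableSet_Icc,
          Set.inter_eq_right.2 (Set.Icc_subset_Icc_left hτ0.le), integral_const_mul,
          integral_Icc_eq_integral_Ioc, ← intervalIntegral.integral_of_le hτ1,
          integral_rpow (Or.inr ⟨by linarith, hnot⟩), Real.one_rpow, hτb]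
        have h3 : (n : ℝ) ^ (-((1 + a) / 2)) = (n : ℝ) ^ ((1 - a) / 2) * (1 / n) := by
          rw [one_div, ← Real.rpow_neg_one, ← Real.rpow_add hn']
          congr 1; ring
        have hb1' : 0 < b - 1 := by linarith
        have h4 : (1 - (n : ℝ) ^ ((1 - a) / 2)) / (-b + 1) =
            ((n : ℝ) ^ ((1 - a) / 2) - 1) / (b - 1) := by
          rw [← neg_div_neg_eq]; congr 1 <;> ring
        rw [h3, h4]
        calc 2 / n * (((n : ℝ) ^ ((1 - a) / 2) - 1) / (b - 1))
            ≤ 2 / n * ((n : ℝ) ^ ((1 - a) / 2) / (b - 1)) := by gcongr; linarith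
          _ = _ := by field_simp
      rw [integral_add hi1 hi2, h1, add_mul, one_mul]
      linarith
  · have hs : 1 ≤ √(n : ℝ) := Real.one_le_sqrt.2 (by exact_mod_cast hn)
    have hn' : (0 : ℝ) < n := by exact_mod_cast hn
    set ε := 1 / (128 * √(n : ℝ)) with hε
    have hε0 : 0 < ε := by positivity
    have hε1 : ε ≤ 1 := by
      rw [hε, div_le_one (by positivity)]; linarith
    have hεa : 0 ≤ ε ^ a := Real.rpow_nonneg hε0.le _
    have hεa1 : ε ^ a ≤ 1 := Real.rpow_le_one hε0.le hε1 ha0.le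
    -- For `u ≤ ε ^ a` the whole interval of radius `r u` lies in the window, so no restriction on
    -- `v` is needed.
    refine ⟨Set.Icc 0 (ε ^ a), Set.Icc 0 1, measurableSet_Icc, measurableSet_Icc,
      fun u hu v hv => ?_, ?_⟩
    · have h1 : u ^ b ≤ ε := by
        calc u ^ b ≤ (ε ^ a) ^ b := Real.rpow_le_rpow hu.1 hu.2 hb0.le
          _ = ε := by
            rw [← Real.rpow_mul hε0.le, hb, mul_one_div_cancel ha0.ne', Real.rpow_one]
      have h0 : 0 ≤ u ^ b := Real.rpow_nonneg hu.1 _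
      have h2 : |2 * v - 1| ≤ 1 := by
        rw [abs_le]; constructor <;> linarith [hv.1, hv.2]
      rw [abs_mul, abs_of_nonneg (by positivity)]
      nlinarith [abs_nonneg (2 * v - 1)]
    · rw [uniformIcc_real_Icc le_rfl hεa hεa1, uniformIcc_real_Icc le_rfl zero_le_one le_rfl]
      apply le_of_eq
      have : ε = 1 / 128 * (n : ℝ) ^ (-(1 / 2) : ℝ) := by
        rw [← one_div_sqrt_eq_rpow, hε]; field_simp
      rw [this, Real.mul_rpow (by norm_num) (Real.rpow_nonneg hn'.le _), ← Real.rpow_mul hn'.le]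
      simp only [sub_zero, mul_one]
      congr 2; ring

theorem exists_centeredMixture_hasWassersteinRate {δ : ℝ} (hδ : δ ∈ Set.Icc (1 / 2 : ℝ) 1) :
    ∃ r : ℝ → ℝ, Measurable r ∧ (∀ u ∈ Set.Icc (0 : ℝ) 1, r u ∈ Set.Icc (0 : ℝ) (1 / 2)) ∧
      HasWassersteinRate mixedBernoulli ((centeredMixture r).prod uniformSeq) Prod.fst
        ((centeredMixture r).prod uniformSeq) δ := by
  rcases hδ.1.eq_or_lt with rfl | h1
  · exact ⟨_, measurable_const, fun u _ => by norm_num, hasWassersteinRate_half⟩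
  rcases hδ.2.eq_or_lt with rfl | h2
  · exact ⟨_, measurable_const, fun u _ => by norm_num, hasWassersteinRate_one⟩
  -- Solves `(1 + a) / 2 = δ`. The power profile excludes the endpoints: `1 / a` degenerates at `a =
  -- 0`, and at `a = 1` the upper bound would pick up a logarithm.
  have ha : 2 * δ - 1 ∈ Set.Ioo (0 : ℝ) 1 := ⟨by linarith, by linarith⟩
  have h := hasWassersteinRate_of_mem_Ioo ha
  rw [show (1 + (2 * δ - 1)) / 2 = δ by ring] at h
  refine ⟨_, by fun_prop, fun u hu => ?_, h⟩
  have hb : 0 ≤ 1 / (2 * δ - 1) := (one_div_pos.2 ha.1).le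
  have h3 := Real.rpow_nonneg hu.1 (1 / (2 * δ - 1))
  have h4 := Real.rpow_le_one hu.1 hu.2 hb
  constructor <;> linarith

theorem proposition4p3 :
    (∀ δ ∈ Set.Icc (1 / 2 : ℝ) 1,
      ∃ (Ω : Type) (_ : MeasurableSpace Ω) (P : Measure Ω) (_ : IsProbabilityMeasure P)
        (X : ℕ → Ω → ℝ), IsExchangeableZeroOne X P ∧
        ∃ θ : Ω → ℝ, Measurable θ ∧
          TendstoInDistribution (empiricalMean X) atTop θ (fun _ => P) P ∧
          HasWassersteinRate X P θ P δ) ∧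
    (∀ {Ω : Type*} [MeasurableSpace Ω] (P : Measure Ω) [IsProbabilityMeasure P]
        {Ω' : Type*} [MeasurableSpace Ω'] (P' : Measure Ω') [IsProbabilityMeasure P']
        (X : ℕ → Ω → ℝ) (θ : Ω' → ℝ) (δ : ℝ),
        IsExchangeableZeroOne X P → Measurable θ → 0 < δ → HasWassersteinRate X P θ P' δ →
        δ ∈ Set.Icc (1 / 2 : ℝ) 1) := by
  refine ⟨fun δ hδ => ?_, ?_⟩
  · obtain ⟨r, hr, hr1, hrate⟩ := exists_centeredMixture_hasWassersteinRate hδ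
    have := isProbabilityMeasure_centeredMixture hr
    exact ⟨ℝ × (ℕ → ℝ), inferInstance, (centeredMixture r).prod uniformSeq, inferInstance,
      mixedBernoulli, isExchangeableZeroOne_mixedBernoulli _, Prod.fst, measurable_fst,
      tendstoInDistribution_empiricalMean_mixedBernoulli _ (ae_centeredMixture_mem hr hr1), hrate⟩
  · intro Ω _ P _ Ω' _ P' _ X θ δ hX hθ hδ h
    have := Measure.isProbabilityMeasure_map (μ := P') hθ.aemeasurable
    exact rate_mem_Icc hX (P'.map θ) hδ h
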